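/- **Setting.** A directive sequence $\boldsymbol\theta=(\theta^{(n)})_{n\ge 0}$ on finite alphabets $(\mathcal A_n)_{n\ge0}$ consists of morphisms $\theta^{(n)}:\mathcal A_{n+1}\to\mathcal A_n^{+}$ (each letter is mapped to a non-empty word), extended to words by concatenation. For $N>n$ put $\theta^{[n,N)}=\theta^{(n)}\circ\cdots\circ\theta^{(N-1)}$. Let $X^{(n)}$ be the set of all $x\in\mathcal A_n^{\mathbb Z}$ such that every finite subword of $x$ is a subword of $\theta^{[n,N)}(a)$ for some $N>n$ and $a\in\mathcal A_N$, let $\sigma$ be the left shift, and put $X_{\boldsymbol\theta}=X^{(0)}$. The sequence has constant length with length sequence $(q_n)_{n\ge0}$ if $|\theta^{(n)}(a)|=q_n$ for all $n\ge0$ and $a\in\mathcal A_{n+1}$. It is then called torsion-free if $q_n>1$ for infinitely many $n$, each $(X^{(n)},\sigma)$ is minimal (in particular $X^{(n)}\ne\emptyset$), $X^{(0)}$ contains no shift-periodic point, and each prime that divides some $q_k$ divides $q_n$ for infinitely many $n$. Let $p_n=q_0\cdots q_{n-1}$ (so $p_0=1$) and let $\mathbb Z_{(q_n)}=\varprojlim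 \mathbb Z/p_n\mathbb Z$ be the odometer group, with its inverse limit topology. A system $(Y,S)$, with $Y$ compact Hausdorff and $S$ a homeomorphism of $Y$, is equicontinuous if $\{S^n:n\in\mathbb Z\}$ is equicontinuous. A factor map is a continuous surjection intertwining the two homeomorphisms. The maximal equicontinuous factor of a system is an equicontinuous factor through which every equicontinuous factor of the system factors. A continuous eigenvalue of $(X_{\boldsymbol\theta},\sigma)$ is a $\lambda\in\mathbb C$ with $|\lambda|=1$ such that $f\circ\sigma=\lambda f$ for some continuous $f:X_{\boldsymbol\theta}\to\mathbb C$ that is not identically zero; it is rational if $\lambda=e^{2\pi i a/b}$ for some integers $a$ and $b\ge1$. **Corollary 4.6.** Let $\boldsymbol\theta$ be a torsion-free directive sequence with length sequence $(q_n)$, on alphabets $\mathcal A_n$ of bounded size. Then there is an integer $h\ge1$, coprime to every $q_n$, such that the maximal equicontinuous factor of $(X_{\boldsymbol\theta},\sigma)$ is $\mathbb Z_{(q_n)}\times\mathbb Z/h\mathbb Z$ with the rotation $z\mapsto z+(1,1)$. In particular, each continuous eigenvalue of $(X_{\boldsymbol\theta},\sigma)$ is rational. -/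

import Mathlib

open Filter

universe u v w

/-! ### Topological dynamics -/

section Dynamics

variable {X : Type u} {Y : Type v}

/-- `π` is a factor map from the system `(X, T)` onto the system `(Y, S)`. -/
structure IsFactorMap [TopologicalSpace X] [TopologicalSpace Y]
    (T : X ≃ₜ X) (S : Y ≃ₜ Y) (π : X → Y) : Prop where
  continuous : Continuous π
  surjective : Function.Surjective π
  semiconj : ∀ x, π (T x) = S (π x)

/-- `(Y, S)` is an equicontinuous topological dynamical system: `Y` is compact Hausdorff (with its
unique compatible uniformity) and the family of the `S ^ n`, `n ∈ ℤ`, is equicontinuous. -/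
structure IsEquicontinuousSystem [UniformSpace Y] (S : Y ≃ₜ Y) : Prop where
  compactSpace : CompactSpace Y
  t2Space : T2Space Y
  equicontinuous : Equicontinuous (fun (n : ℤ) (y : Y) => (S ^ n) y)

/-- `(Z, R)`, with the factor map `π`, is the maximal equicontinuous factor of `(X, T)`:
it is an equicontinuous factor, and every equicontinuous factor of `(X, T)` factors through it. -/
structure IsMaximalEquicontinuousFactor {X : Type u} {Z : Type v}
    [TopologicalSpace X] [UniformSpace Z]
    (T : X ≃ₜ X) (R : Z ≃ₜ Z) (π : X → Z) : Prop where
  isEquicontinuousSystem : IsEquicontinuousSystem R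
  isFactorMap : IsFactorMap T R π
  exists_factor : ∀ (Y : Type w) [UniformSpace Y] (S : Y ≃ₜ Y) (φ : X → Y),
    IsEquicontinuousSystem S → IsFactorMap T S φ →
      ∃ ψ : Z → Y, IsFactorMap R S ψ ∧ ∀ x, ψ (π x) = φ x

/-- `c`, of modulus one, is a continuous eigenvalue of `(X, T)`: there is a continuous
eigenfunction (not identically zero) with eigenvalue `c`. -/
def IsContinuousEigenvalue [TopologicalSpace X] (T : X ≃ₜ X) (c : ℂ) : Prop :=
  ‖c‖ = 1 ∧ ∃ f : X → ℂ, Continuous f ∧ f ≠ 0 ∧ ∀ x, f (T x) = c * f x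

/-- `c = exp (2 π i a / b)` for some integers `a` and `b ≥ 1`. -/
def IsRationalEigenvalue (c : ℂ) : Prop :=
  ∃ (a : ℤ) (b : ℕ), 0 < b ∧ c = Complex.exp (2 * Real.pi * Complex.I * (a / b))

end Dynamics

/-! ### Odometers -/

section Odometer

/-- Each finite cyclic group carries the discrete uniformity. -/
instance ZMod.discreteUniformSpace (N : ℕ) : UniformSpace (ZMod N) := ⊥

/-- `p n = q 0 * ⋯ * q (n - 1)`. -/
def lengthProd (q : ℕ → ℕ) (n : ℕ) : ℕ := ∏ i ∈ Finset.range n, q i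

theorem lengthProd_dvd_succ (q : ℕ → ℕ) (n : ℕ) : lengthProd q n ∣ lengthProd q (n + 1) :=
  ⟨q n, Finset.prod_range_succ q n⟩

/-- The odometer `ℤ_(q_n)`: the inverse limit of the cyclic groups `ℤ / p n`, along the reduction
maps, with the topology and uniformity induced by the product. The unit `1` of the inverse limit
is the sequence of the residues of the integer `1`. -/
def Odometer (q : ℕ → ℕ) : Subring (∀ n, ZMod (lengthProd q n)) where
  carrier := {z | ∀ n, ZMod.castHom (lengthProd_dvd_succ q n) (ZMod (lengthProd q n)) (z (n + 1))
    = z n}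
  mul_mem' ha hb n := by simp only [Pi.mul_apply, map_mul, ha n, hb n]
  one_mem' n := by simp only [Pi.one_apply, map_one]
  add_mem' ha hb n := by simp only [Pi.add_apply, map_add, ha n, hb n]
  zero_mem' n := by simp only [Pi.zero_apply, map_zero]
  neg_mem' ha n := by simp only [Pi.neg_apply, map_neg, ha n]

/-- The rotation `z ↦ z + (1, 1)` of `ℤ_(q_n) × ℤ / h`. -/
def odometerRotation (q : ℕ → ℕ) (h : ℕ) : Odometer q × ZMod h ≃ₜ Odometer q × ZMod h :=
  Homeomorph.addRight (1, 1)

end Odometer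

/-! ### Shifts -/

section Shift

variable {α : Type u} [TopologicalSpace α]

/-- The left shift `(x i) ↦ (x (i + 1))` on two-sided sequences. -/
def leftShift (α : Type u) [TopologicalSpace α] : (ℤ → α) ≃ₜ (ℤ → α) where
  toFun x i := x (i + 1)
  invFun x i := x (i - 1)
  left_inv x := by funext i; simp
  right_inv x := by funext i; simp
  continuous_toFun := by fun_prop
  continuous_invFun := by fun_prop

/-- A (nonempty) shift `X` is minimal if its only closed shift-invariant subsets are
`∅` and `X`. -/
def IsMinimalShift (X : Set (ℤ → α)) : Prop :=
  X.Nonempty ∧ ∀ C ⊆ X, IsClosed C → leftShift α '' C = C → C = ∅ ∨ C = X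

/-- A shift is aperiodic if none of its points is periodic. -/
def IsAperiodicShift (X : Set (ℤ → α)) : Prop :=
  ∀ x ∈ X, ∀ k : ℕ, 1 ≤ k → (leftShift α)^[k] x ≠ x

end Shift

/-- The word `x_k x_{k+1} ⋯ x_{k+m-1}`. -/
def subwordAt {α : Type u} (x : ℤ → α) (k : ℤ) (m : ℕ) : List α :=
  List.ofFn (fun i : Fin m => x (k + i))

/-! ### Directive sequences -/

/-- A directive sequence on the alphabets `A n`: morphisms sending each letter of `A (n + 1)` to
a nonempty word over `A n`. -/
structure DirectiveSequence (A : ℕ → Type u) where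
  morphism : ∀ n, A (n + 1) → List (A n)
  morphism_ne_nil : ∀ n a, morphism n a ≠ []

namespace DirectiveSequence

variable {A : ℕ → Type u} (θ : DirectiveSequence A)

/-- `θ.compWord n k a` is the word `θ^{[n, n+k)}(a)` over `A n`, for a letter `a` of `A (n + k)`;
here `θ^{[n, n+k+1)} = θ^{[n, n+k)} ∘ θ^{(n+k)}`. -/
def compWord (n : ℕ) : (k : ℕ) → A (n + k) → List (A n)
  | 0, a => [a]
  | k + 1, a => (θ.morphism (n + k) a).flatMap (compWord n k)

/-- The language of all subwords of the words `θ^{[n, N)}(a)`, for `N > n` and `a` in `A N`. -/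
def language (n : ℕ) : Set (List (A n)) :=
  {w | ∃ k : ℕ, 1 ≤ k ∧ ∃ a : A (n + k), w <:+: θ.compWord n k a}

/-- The shift `X^{(n)}`: all two-sided sequences whose subwords are all in the language at
level `n`. -/
def levelShift (n : ℕ) : Set (ℤ → A n) :=
  {x | ∀ (k : ℤ) (m : ℕ), subwordAt x k m ∈ θ.language n}

theorem mem_levelShift_iff [∀ n, TopologicalSpace (A n)] (n : ℕ) (x : ℤ → A n) :
    x ∈ θ.levelShift n ↔ leftShift (A n) x ∈ θ.levelShift n := by
  have key : ∀ (k : ℤ) (m : ℕ), subwordAt (leftShift (A n) x) k m = subwordAt x (k + 1) m := by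
    intro k m
    unfold subwordAt
    congr 1
    funext i
    change x (k + i + 1) = x (k + 1 + i)
    congr 1
    ring
  constructor
  · intro h k m
    rw [key]
    exact h (k + 1) m
  · intro h k m
    have h1 := h (k - 1) m
    rwa [key, sub_add_cancel] at h1

/-- The left shift as a self-homeomorphism of the `S`-adic shift `X_θ = X^{(0)}`. -/
def shiftMap [∀ n, TopologicalSpace (A n)] : θ.levelShift 0 ≃ₜ θ.levelShift 0 :=
  (leftShift (A 0)).subtype (θ.mem_levelShift_iff 0)

/-- The directive sequence is of constant length, with length sequence `q`. -/
def HasLengthSequence (q : ℕ → ℕ) : Prop :=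
  ∀ n a, (θ.morphism n a).length = q n

/-- A directive sequence is torsion-free, with length sequence `q`. -/
structure IsTorsionFree [∀ n, TopologicalSpace (A n)] (q : ℕ → ℕ) : Prop where
  hasLengthSequence : θ.HasLengthSequence q
  frequently_one_lt : ∃ᶠ n in atTop, 1 < q n
  isMinimalShift : ∀ n, IsMinimalShift (θ.levelShift n)
  isAperiodicShift : IsAperiodicShift (θ.levelShift 0)
  frequently_dvd : ∀ p : ℕ, p.Prime → ∀ k, p ∣ q k → ∃ᶠ n in atTop, p ∣ q n

end DirectiveSequence

/-- The sizes of the alphabets `A n` are bounded. -/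
def HasBoundedAlphabets (A : ℕ → Type u) : Prop :=
  ∃ K : ℕ, ∀ n, Nat.card (A n) ≤ K

/-! Write p_n for `lengthProd q n`, σ for the shift of X_θ, and B_n for the image of X^{(n)} under
θ^{[0,n)} (`blockSet`). Minimality of X^{(n)} makes B_n minimal for σ^{p_n}, so its translates form
a finite clopen partition of X_θ, which is a cyclic factor of some order c dividing p_n. A window of
length p_n - c is determined by the translate and one letter of `A n`, so there are at most c K such
words, where K bounds the alphabets. By aperiodicity and Morse–Hedlund there are more than p_n - c
of them, hence p_n / c ≤ K (`exists_isCyclicFactor_mul_eq`). Since a prime dividing one q_k divides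
infinitely many, this bounded loss is recovered at deeper levels: every ℤ/p_n is a factor, and so is
the odometer.

On a fibre of the factor ℤ/p_n, a window of length p_n, suitably placed, is determined by one
letter, so takes at most K values (`exists_label`). This has two consequences. A cyclic factor of
order coprime to all q_n has order at most K, which yields a largest such order h (`exists_height`).
And for an almost periodic function F and ε > 0, take n so large that the window controls F up to ε
along whole orbits: the fibre is then covered by K sets of ε-close points, so any ε-chain inside it
shortens to at most 2K + 1 steps. Being joined by such a chain is an invariant relation with open
classes, that is, the kernel of a finite cyclic factor. Letting ε tend to 0, F identifies all points
that no finite cyclic factor separates (`eq_of_almostPeriodic`).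

By prime factorization, the orders p_n and h account for all finite cyclic factors
(`isCyclicFactor_eq`). So equicontinuous factors and eigenfunctions descend to the odometer times
ℤ/h, and continuity there forces an eigenvalue to be a root of unity. -/

/-! ### Minimal systems and their finite cyclic factors -/

section Cyclic

variable {X : Type u} [TopologicalSpace X]

/-- The only closed invariant subsets of the system `(X, T)` are `∅` and `X`. -/
def IsMinimalSystem (T : X ≃ₜ X) : Prop :=
  ∀ C : Set X, IsClosed C → (∀ x, T x ∈ C ↔ x ∈ C) → C = ∅ ∨ C = Set.univ

/-- `g` is a continuous equivariant map from `(X, T)` to the rotation by `1` on `ℤ / m`. -/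
structure IsCyclicFactor (T : X ≃ₜ X) (m : ℕ) (g : X → ZMod m) : Prop where
  isLocallyConstant : IsLocallyConstant g
  map_apply : ∀ x, g (T x) = g x + 1

theorem Homeomorph.zpow_add_apply (T : X ≃ₜ X) (j k : ℤ) (x : X) :
    (T ^ (j + k)) x = (T ^ j) ((T ^ k) x) := by
  rw [zpow_add]; rfl

theorem Homeomorph.zpow_one_add_apply (T : X ≃ₜ X) (k : ℤ) (x : X) :
    (T ^ (k + 1)) x = T ((T ^ k) x) := by
  rw [add_comm, Homeomorph.zpow_add_apply, zpow_one]

theorem Homeomorph.zpow_apply_apply (T : X ≃ₜ X) (k : ℤ) (x : X) :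
    (T ^ (k + 1)) x = (T ^ k) (T x) := by
  rw [Homeomorph.zpow_add_apply, zpow_one]

theorem Homeomorph.zpow_zero_apply (T : X ≃ₜ X) (x : X) : (T ^ (0 : ℤ)) x = x := by
  rw [zpow_zero]; rfl

theorem Homeomorph.zpow_neg_apply_zpow (T : X ≃ₜ X) (k : ℤ) (x : X) :
    (T ^ (-k)) ((T ^ k) x) = x := by
  rw [← Homeomorph.zpow_add_apply, neg_add_cancel, Homeomorph.zpow_zero_apply]

theorem Homeomorph.zpow_apply_zpow_neg (T : X ≃ₜ X) (k : ℤ) (x : X) :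
    (T ^ k) ((T ^ (-k)) x) = x := by
  rw [← Homeomorph.zpow_add_apply, add_neg_cancel, Homeomorph.zpow_zero_apply]

/-- The complement of the union of all translates of `U` is closed, invariant and not the whole
space, hence empty. -/
theorem IsMinimalSystem.exists_zpow_mem {T : X ≃ₜ X} (hT : IsMinimalSystem T) {U : Set X}
    (hU : IsOpen U) (hne : U.Nonempty) (x : X) : ∃ k : ℤ, (T ^ k) x ∈ U := by
  by_contra! hx
  have hcl : IsClosed (⋃ k : ℤ, (T ^ k) ⁻¹' U)ᶜ :=
    (isOpen_iUnion fun k => hU.preimage (T ^ k).continuous).isClosed_compl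
  rcases hT _ hcl (fun y => by
    simp only [Set.mem_compl_iff, Set.mem_iUnion, Set.mem_preimage, not_exists]
    constructor
    · intro h k
      have := h (k - 1)
      rwa [← Homeomorph.zpow_apply_apply, sub_add_cancel] at this
    · intro h k
      have := h (k + 1)
      rwa [Homeomorph.zpow_apply_apply] at this) with h | h
  · have : x ∈ (⋃ k : ℤ, (T ^ k) ⁻¹' U)ᶜ := by simpa using hx
    rw [h] at this
    exact this
  · obtain ⟨y, hy⟩ := hne
    have : y ∈ (⋃ k : ℤ, (T ^ k) ⁻¹' U)ᶜ := by rw [h]; trivial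
    simp only [Set.mem_compl_iff, Set.mem_iUnion, Set.mem_preimage, not_exists] at this
    exact this 0 (by rwa [Homeomorph.zpow_zero_apply])

namespace IsCyclicFactor

variable {T : X ≃ₜ X} {m : ℕ} {g g' : X → ZMod m}

theorem map_zpow (hg : IsCyclicFactor T m g) (k : ℤ) :
    ∀ x, g ((T ^ k) x) = g x + k := by
  induction k with
  | zero => intro x; simp
  | succ i ih =>
    intro x; rw [Homeomorph.zpow_one_add_apply, hg.map_apply, ih]; push_cast; ring
  | pred i ih =>
    intro x
    have h := ih x
    rw [← sub_add_cancel (-(i : ℤ)) 1, Homeomorph.zpow_one_add_apply, hg.map_apply] at h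
    rw [eq_sub_of_add_eq h]; push_cast; ring

theorem castHom (hg : IsCyclicFactor T m g) {d : ℕ} (hd : d ∣ m) :
    IsCyclicFactor T d (fun x => ZMod.castHom hd (ZMod d) (g x)) where
  isLocallyConstant := hg.isLocallyConstant.comp (ZMod.castHom hd (ZMod d))
  map_apply x := by rw [hg.map_apply, map_add, map_one]

theorem add_const (hg : IsCyclicFactor T m g) (c : ZMod m) :
    IsCyclicFactor T m (fun x => g x + c) where
  isLocallyConstant := hg.isLocallyConstant.comp (· + c)
  map_apply x := by rw [hg.map_apply]; ring

theorem chineseRemainder (hg : IsCyclicFactor T m g) {n : ℕ} {f : X → ZMod n}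
    (hf : IsCyclicFactor T n f) (h : m.Coprime n) :
    IsCyclicFactor T (m * n) (fun x => (ZMod.chineseRemainder h).symm (g x, f x)) where
  isLocallyConstant :=
    (hg.isLocallyConstant.prodMk hf.isLocallyConstant).comp (ZMod.chineseRemainder h).symm
  map_apply x := by
    rw [hg.map_apply, hf.map_apply, ← map_one (ZMod.chineseRemainder h).symm, ← map_add]
    rfl

/-- Two cyclic factor maps of the same order differ by a constant. -/
theorem eq_add_const (hT : IsMinimalSystem T) (hg : IsCyclicFactor T m g)
    (hg' : IsCyclicFactor T m g') (x y : X) : g' x = g x + (g' y - g y) := by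
  have hloc : IsLocallyConstant fun x => g' x - g x :=
    hg'.isLocallyConstant.comp₂ hg.isLocallyConstant (· - ·)
  rcases hT {z | g' z - g z = g' y - g y}
    (hloc.isClosed_fiber _) (fun z => by
      simp only [Set.mem_ofPred_eq, hg.map_apply, hg'.map_apply, add_sub_add_right_eq_sub])
    with h | h
  · have : y ∈ {z | g' z - g z = g' y - g y} := rfl
    rw [h] at this
    exact this.elim
  · have : x ∈ {z | g' z - g z = g' y - g y} := by rw [h]; trivial
    rw [← this.out]; ring

end IsCyclicFactor

/-- An invariant equivalence relation with open classes on a minimal compact system is the kernel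
of a finite cyclic factor map. -/
theorem IsMinimalSystem.exists_isCyclicFactor_of_setoid [CompactSpace X] [Nonempty X]
    {T : X ≃ₜ X} (hT : IsMinimalSystem T) (s : Setoid X) (hs : ∀ x y, s (T x) (T y) ↔ s x y)
    (ho : ∀ x, IsOpen {y | s x y}) :
    ∃ (m : ℕ) (g : X → ZMod m), 0 < m ∧ IsCyclicFactor T m g ∧ ∀ x y, g x = g y ↔ s x y := by
  obtain ⟨x₀⟩ := ‹Nonempty X›
  have hsz : ∀ (k : ℤ) x y, s ((T ^ k) x) ((T ^ k) y) ↔ s x y := by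
    intro k
    induction k with
    | zero => intro x y; simp only [Homeomorph.zpow_zero_apply]
    | succ i ih => intro x y; rw [Homeomorph.zpow_one_add_apply, Homeomorph.zpow_one_add_apply,
        hs, ih]
    | pred i ih =>
      intro x y
      rw [← hs, ← Homeomorph.zpow_one_add_apply, ← Homeomorph.zpow_one_add_apply, sub_add_cancel,
        ih]
  -- The return times of `x₀` to its own class; a generator of this group is the order m, and the
  -- class of T^k x₀ will be sent to k mod m.
  let H : AddSubgroup ℤ :=
    { carrier := {k | s ((T ^ k) x₀) x₀}
      zero_mem' := by
        simp only [Set.mem_ofPred_eq, Homeomorph.zpow_zero_apply]; exact s.refl _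
      add_mem' := by
        intro a b ha hb
        simp only [Set.mem_ofPred_eq] at ha hb ⊢
        rw [Homeomorph.zpow_add_apply]
        exact s.trans ((hsz a _ _).2 hb) ha
      neg_mem' := by
        intro a ha
        simp only [Set.mem_ofPred_eq] at ha ⊢
        rw [← hsz a, Homeomorph.zpow_apply_zpow_neg]
        exact s.symm ha }
  have hH : ∀ i j : ℤ, s ((T ^ i) x₀) ((T ^ j) x₀) ↔ i - j ∈ H := by
    intro i j
    rw [← hsz (-j), Homeomorph.zpow_neg_apply_zpow, ← Homeomorph.zpow_add_apply,
      neg_add_eq_sub]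
    rfl
  have hfin : Finite (Quotient s) := by
    have : DiscreteTopology (Quotient s) := by
      rw [discreteTopology_iff_isOpen_singleton]
      intro a
      induction a using Quotient.inductionOn with
      | h x =>
        rw [← isQuotientMap_quotient_mk'.isOpen_preimage]
        convert ho x using 1
        ext y
        simp only [Set.mem_preimage, Set.mem_singleton_iff, Set.mem_ofPred_eq]
        exact Quotient.eq.trans s.comm
    exact finite_of_compact_of_discrete
  -- There are finitely many classes, so two iterates of `x₀` share one; this makes `H` nonzero,
  -- hence m positive.
  obtain ⟨i, j, hij, he⟩ := Finite.exists_ne_map_eq_of_infinite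
    (fun k : ℤ => (Quotient.mk s ((T ^ k) x₀)))
  have hijH : i - j ∈ H := (hH i j).1 (Quotient.exact he)
  obtain ⟨a, ha⟩ := Int.subgroup_cyclic H
  have hmem : ∀ k : ℤ, k ∈ H ↔ (a.natAbs : ℤ) ∣ k := by
    intro k
    rw [ha, AddSubgroup.mem_closure_singleton, Int.natAbs_dvd]
    constructor
    · rintro ⟨n, rfl⟩; exact ⟨n, by simp [mul_comm]⟩
    · rintro ⟨n, rfl⟩; exact ⟨n, by simp [mul_comm]⟩
  have hcov : ∀ x, ∃ k : ℤ, s x ((T ^ k) x₀) := fun x =>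
    hT.exists_zpow_mem (ho x) ⟨x, s.refl x⟩ x₀
  choose k hk using hcov
  have hker : ∀ x y, ((k x : ZMod a.natAbs) = k y) ↔ s x y := by
    intro x y
    rw [eq_comm, ZMod.intCast_eq_intCast_iff_dvd_sub, ← hmem, ← hH]
    exact ⟨fun h => s.trans (hk x) (s.trans h (s.symm (hk y))),
      fun h => s.trans (s.symm (hk x)) (s.trans h (hk y))⟩
  refine ⟨a.natAbs, fun x => (k x : ZMod a.natAbs), ?_, ⟨?_, ?_⟩, hker⟩
  · rw [Int.natAbs_pos]
    rintro rfl
    rw [hmem] at hijH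
    simp [sub_eq_zero, hij] at hijH
  · rw [IsLocallyConstant.iff_eventually_eq]
    intro x
    filter_upwards [(ho x).mem_nhds (s.refl x)] with y hy
    exact (hker y x).2 (s.symm hy)
  · intro x
    have : ((k (T x) : ℤ) : ZMod a.natAbs) = ((k x + 1 : ℤ) : ZMod a.natAbs) := by
      rw [eq_comm, ZMod.intCast_eq_intCast_iff_dvd_sub, ← hmem, ← hH,
        Homeomorph.zpow_one_add_apply]
      exact s.trans (s.symm (hk (T x))) ((hs _ _).2 (hk x))
    rw [this]; push_cast; rfl

end Cyclic

/-! ### Chains through finitely many cliques -/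

/-- If a space is covered by finitely many cliques of the relation `D 1` then chains for `D 1` can
be shortened to a bounded number of steps. -/
theorem rel_of_reflTransGen_of_finite_cliques {α : Type u} {ι : Type v} [Finite ι] (l : α → ι)
    (D : ℕ → α → α → Prop) (hadd : ∀ i j a b c, D i a b → D j b c → D (i + j) a c)
    (hsymm : ∀ a b, D 1 a b → D 1 b a) (hmono : ∀ i j a b, i ≤ j → D i a b → D j a b)
    (hl : ∀ a b, l a = l b → D 1 a b) {a b : α} (hab : Relation.ReflTransGen (D 1) a b) :
    D (2 * Nat.card ι + 1) a b := by
  classical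
  have := Fintype.ofFinite ι
  -- A simple path of labels has fewer edges than there are labels; each edge costs one step and
  -- each vertex one step inside its clique.
  let G : SimpleGraph ι :=
    { Adj := fun i j => i ≠ j ∧ ∃ a b, l a = i ∧ l b = j ∧ D 1 a b
      symm := ⟨fun i j ⟨hij, a, b, ha, hb, h⟩ => ⟨hij.symm, b, a, hb, ha, hsymm _ _ h⟩⟩
      loopless := ⟨fun i h => h.1 rfl⟩ }
  have hreach : G.Reachable (l a) (l b) := by
    induction hab with
    | refl => exact SimpleGraph.Reachable.refl _
    | tail _ h ih =>
      rename_i c d _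
      by_cases hcd : l c = l d
      · rwa [← hcd]
      · exact ih.trans (SimpleGraph.Adj.reachable ⟨hcd, c, d, rfl, rfl, h⟩)
  have hwalk : ∀ (i j : ι) (p : G.Walk i j) (a b : α), l a = i → l b = j →
      D (2 * p.length + 1) a b := by
    intro i j p
    induction p with
    | nil => intro a b ha hb; simpa using hl a b (ha.trans hb.symm)
    | cons h p ih =>
      intro a b ha hb
      obtain ⟨-, c, d, hc, hd, hcd⟩ := h
      have := hadd _ _ _ _ _ (hadd _ _ _ _ _ (hl a c (ha.trans hc.symm)) hcd) (ih d b hd hb)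
      rw [SimpleGraph.Walk.length_cons]
      exact hmono _ _ _ _ (by omega) this
  obtain ⟨p, hp⟩ := hreach.exists_isPath
  have hlt := hp.length_lt
  rw [← Nat.card_eq_fintype_card] at hlt
  exact hmono _ _ _ _ (by omega) (hwalk _ _ p a b rfl rfl)

/-! ### The Morse–Hedlund theorem -/

section MorseHedlund

variable {α : Type u} [Finite α] {X : Set (ℤ → α)}

/-- The words of length `l` of a shift-invariant set, read at the origin. -/
def wordsOfLength (X : Set (ℤ → α)) (l : ℕ) : Set (Fin l → α) :=
  (fun x i => x (i : ℕ)) '' X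

/-- The number of words cannot grow strictly at each length, as it would then exceed `L` at length
`L`. Where it does not grow, deleting the last or the first letter is injective, so a window
determines its neighbours on both sides, and a repeated window of `x` propagates to a period. -/
theorem exists_periodic_of_ncard_wordsOfLength_le
    (hX : ∀ x ∈ X, ∀ k : ℤ, (fun i => x (i + k)) ∈ X) {L : ℕ}
    (hL : (wordsOfLength X L).ncard ≤ L) {x : ℤ → α} (hx : x ∈ X) :
    ∃ k : ℕ, 1 ≤ k ∧ ∀ i, x (i + k) = x i := by
  have hinit : ∀ l, (fun (w : Fin (l + 1) → α) (i : Fin l) => w i.castSucc) ''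
      wordsOfLength X (l + 1) = wordsOfLength X l := by
    intro l
    ext w
    constructor
    · rintro ⟨_, ⟨y, hy, rfl⟩, rfl⟩; exact ⟨y, hy, rfl⟩
    · rintro ⟨y, hy, rfl⟩; exact ⟨_, ⟨y, hy, rfl⟩, rfl⟩
  have htail : ∀ l, (fun (w : Fin (l + 1) → α) (i : Fin l) => w i.succ) ''
      wordsOfLength X (l + 1) = wordsOfLength X l := by
    intro l
    ext w
    constructor
    · rintro ⟨_, ⟨y, hy, rfl⟩, rfl⟩
      exact ⟨_, hX y hy 1, by funext i; simp⟩
    · rintro ⟨y, hy, rfl⟩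
      exact ⟨_, ⟨_, hX y hy (-1), rfl⟩, by funext i; simp⟩
  obtain ⟨l, hl⟩ : ∃ l, (wordsOfLength X (l + 1)).ncard ≤ (wordsOfLength X l).ncard := by
    by_contra! hlt
    have : ∀ l, l + 1 ≤ (wordsOfLength X l).ncard := by
      intro l
      induction l with
      | zero =>
        have : (wordsOfLength X 0).Nonempty := ⟨_, x, hx, rfl⟩
        exact (Set.ncard_pos).2 this
      | succ l ih => have := hlt l; omega
    have := this L
    omega
  have hinj₁ := Set.injOn_of_ncard_image_eq
    (le_antisymm (Set.ncard_image_le (Set.toFinite _)) (hl.trans_eq (congrArg _ (hinit l).symm)))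
    (Set.toFinite _)
  have hinj₂ := Set.injOn_of_ncard_image_eq
    (le_antisymm (Set.ncard_image_le (Set.toFinite _)) (hl.trans_eq (congrArg _ (htail l).symm)))
    (Set.toFinite _)
  have hW : ∀ k : ℤ, (fun i : Fin (l + 1) => x (k + (i : ℕ))) ∈ wordsOfLength X (l + 1) :=
    fun k => ⟨_, hX x hx k, by funext i; simp [add_comm]⟩
  obtain ⟨i, j, hij, he⟩ : ∃ i j : ℤ, i < j ∧
      (fun t : Fin (l + 1) => x (i + (t : ℕ))) = fun t : Fin (l + 1) => x (j + (t : ℕ)) := by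
    obtain ⟨i, j, hne, he⟩ := Finite.exists_ne_map_eq_of_infinite
      (fun (k : ℤ) (t : Fin (l + 1)) => x (k + (t : ℕ)))
    rcases lt_or_gt_of_ne hne with h | h
    · exact ⟨i, j, h, he⟩
    · exact ⟨j, i, h, he.symm⟩
  have key : ∀ t : ℤ, (fun r : Fin (l + 1) => x (i + t + (r : ℕ))) =
      fun r : Fin (l + 1) => x (j + t + (r : ℕ)) := by
    intro t
    induction t with
    | zero => simpa using he
    | succ t ih =>
      apply hinj₁ (hW _) (hW _)
      funext r
      have := congrFun ih r.succ
      simp only [Fin.val_succ, Fin.val_castSucc] at this ⊢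
      push_cast at this
      convert this using 2 <;> ring
    | pred t ih =>
      apply hinj₂ (hW _) (hW _)
      funext r
      have := congrFun ih r.castSucc
      simp only [Fin.val_succ, Fin.val_castSucc] at this ⊢
      push_cast
      convert this using 2 <;> ring
  refine ⟨(j - i).toNat, by omega, fun t => ?_⟩
  have := congrFun (key (t - i)) 0
  simp only [Fin.val_zero] at this
  rw [Int.toNat_of_nonneg (by omega)]
  convert this.symm using 2 <;> push_cast <;> ring

end MorseHedlund

/-! ### Subwords -/

section Subword

variable {α : Type u}

theorem subwordAt_zero (x : ℤ → α) (k : ℤ) : subwordAt x k 0 = [] := by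
  simp [subwordAt]

theorem subwordAt_add (x : ℤ → α) (k : ℤ) (a b : ℕ) :
    subwordAt x k (a + b) = subwordAt x k a ++ subwordAt x (k + a) b := by
  simp only [subwordAt, List.ofFn_add]
  congr 2
  funext i
  simp [add_assoc]

theorem subwordAt_isInfix (x : ℤ → α) (k : ℤ) (a b c : ℕ) :
    subwordAt x (k + a) b <:+: subwordAt x k (a + b + c) := by
  rw [subwordAt_add, subwordAt_add]
  exact ⟨_, _, rfl⟩

theorem List.IsInfix.flatMap_right {β : Type v} {l l' : List α} (h : l <:+: l')
    (f : α → List β) : l.flatMap f <:+: l'.flatMap f := by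
  obtain ⟨s, t, rfl⟩ := h
  simp only [List.flatMap_append]
  exact ⟨_, _, rfl⟩

end Subword

/-! ### Constant-length morphisms acting on two-sided sequences -/

namespace DirectiveSequence

variable {A : ℕ → Type u} (θ : DirectiveSequence A)

theorem length_morphism_pos (n : ℕ) (a : A (n + 1)) : 0 < (θ.morphism n a).length :=
  List.length_pos_of_ne_nil (θ.morphism_ne_nil n a)

/-- The indices `n + 1 + k` and `n + (k + 1)` are equal but not definitionally, so associativity of
the composed morphisms is proved up to `HEq`. -/
theorem heq_morphism {m m' : ℕ} (e : m = m') {a : A (m + 1)} {b : A (m' + 1)} (h : a ≍ b) :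
    θ.morphism m a ≍ θ.morphism m' b := by
  subst e; cases h; rfl

theorem flatMap_eq_of_heq {β : Type v} {m m' : ℕ} (e : m = m') {l : List (A m)}
    {l' : List (A m')} (h : l ≍ l') {f : A m → List β} {g : A m' → List β}
    (hfg : ∀ a b, a ≍ b → f a = g b) : l.flatMap f = l'.flatMap g := by
  subst e; cases h
  rw [funext fun a => hfg a a HEq.rfl]

/-- `θ^{[n, n+k+1)} = θ^{(n)} ∘ θ^{[n+1, n+1+k)}`. -/
theorem compWord_succ_eq (n k : ℕ) : ∀ (a : A (n + 1 + k)) (b : A (n + (k + 1))), b ≍ a →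
    θ.compWord n (k + 1) b = (θ.compWord (n + 1) k a).flatMap (θ.morphism n) := by
  induction k with
  | zero =>
    intro a b h
    cases h
    simp [compWord]
  | succ k ih =>
    intro a b h
    rw [compWord, compWord, List.flatMap_assoc]
    have e : n + (k + 1) = n + 1 + k := by omega
    exact flatMap_eq_of_heq e (θ.heq_morphism e h) fun c d hcd => ih d c hcd

theorem flatMap_morphism_mem_language {n : ℕ} {w : List (A (n + 1))}
    (hw : w ∈ θ.language (n + 1)) : w.flatMap (θ.morphism n) ∈ θ.language n := by
  obtain ⟨k, hk, a, ha⟩ := hw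
  have e : n + 1 + k = n + (k + 1) := by omega
  refine ⟨k + 1, by omega, cast (congrArg A e) a, ?_⟩
  rw [θ.compWord_succ_eq n k a _ (cast_heq _ _)]
  exact ha.flatMap_right _

theorem mem_language_of_isInfix {n : ℕ} {w w' : List (A n)} (h : w <:+: w')
    (hw : w' ∈ θ.language n) : w ∈ θ.language n := by
  obtain ⟨k, hk, a, ha⟩ := hw
  exact ⟨k, hk, a, h.trans ha⟩

/-- The letter of `θ^{(n)}(a)` at the position `i` modulo the length. -/
def letterAt (n : ℕ) (a : A (n + 1)) (i : ℤ) : A n :=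
  (θ.morphism n a)[(i % (θ.morphism n a).length).toNat]'(by
    have := θ.length_morphism_pos n a
    have := Int.emod_lt_of_pos i (Int.natCast_pos.2 this)
    omega)

theorem letterAt_eq_getElem (n : ℕ) (a : A (n + 1)) {i : ℤ} {r : ℕ}
    (hr : r < (θ.morphism n a).length) (hi : i % (θ.morphism n a).length = r) :
    θ.letterAt n a i = (θ.morphism n a)[r] := by
  simp only [letterAt, hi, Int.toNat_natCast]

theorem letterAt_add_length_mul (n : ℕ) (a : A (n + 1)) (i j : ℤ) :
    θ.letterAt n a (i + (θ.morphism n a).length * j) = θ.letterAt n a i := by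
  simp only [letterAt, Int.add_mul_emod_self_left]

/-- The action of `θ^{(n)}`, of constant length `q n`, on two-sided sequences. -/
def stepMap (q : ℕ → ℕ) (n : ℕ) (y : ℤ → A (n + 1)) : ℤ → A n :=
  fun i => θ.letterAt n (y (i / q n)) i

/-- The action of `θ^{[0, n)}`, of constant length, on two-sided sequences. -/
def subMap (q : ℕ → ℕ) : (n : ℕ) → (ℤ → A n) → (ℤ → A 0)
  | 0, y => y
  | n + 1, y => subMap q n (θ.stepMap q n y)

theorem _root_.lengthProd_succ (q : ℕ → ℕ) (n : ℕ) :
    lengthProd q (n + 1) = lengthProd q n * q n :=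
  Finset.prod_range_succ q n

theorem _root_.lengthProd_zero (q : ℕ → ℕ) : lengthProd q 0 = 1 := rfl

/-- A coordinate of the image depends only on the letter whose block contains it. This is what turns
the alphabet bound into a bound on numbers of windows. -/
theorem subMap_apply_congr {q : ℕ → ℕ} (n : ℕ) : ∀ {y y' : ℤ → A n} {i : ℤ},
    y (i / lengthProd q n) = y' (i / lengthProd q n) → θ.subMap q n y i = θ.subMap q n y' i := by
  induction n with
  | zero => intro y y' i h; simpa [lengthProd_zero, subMap] using h
  | succ n ih =>
    intro y y' i h
    apply ih
    simp only [stepMap]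
    rw [Int.ediv_ediv_of_nonneg (by positivity), ← Nat.cast_mul, ← lengthProd_succ, h]

variable {θ} {q : ℕ → ℕ}

theorem HasLengthSequence.pos (hq : θ.HasLengthSequence q) [∀ n, Nonempty (A n)] (n : ℕ) :
    0 < q n := by
  obtain ⟨a⟩ := ‹∀ n, Nonempty (A n)› (n + 1)
  rw [← hq n a]
  exact θ.length_morphism_pos n a

theorem HasLengthSequence.lengthProd_pos (hq : θ.HasLengthSequence q) [∀ n, Nonempty (A n)]
    (n : ℕ) : 0 < lengthProd q n :=
  Finset.prod_pos fun i _ => hq.pos i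

theorem HasLengthSequence.stepMap_add (hq : θ.HasLengthSequence q) [∀ n, Nonempty (A n)] (n : ℕ)
    (y : ℤ → A (n + 1)) (j : ℤ) :
    θ.stepMap q n (fun i => y (i + j)) = fun i => θ.stepMap q n y (i + q n * j) := by
  funext i
  have := hq.pos n
  simp only [stepMap]
  rw [Int.add_mul_ediv_left _ _ (by omega), ← letterAt_add_length_mul _ _ _ _ j, hq]

theorem HasLengthSequence.subMap_add (hq : θ.HasLengthSequence q) [∀ n, Nonempty (A n)] (n : ℕ) :
    ∀ (y : ℤ → A n) (j : ℤ),
    θ.subMap q n (fun i => y (i + j)) = fun i => θ.subMap q n y (i + lengthProd q n * j) := by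
  induction n with
  | zero => intro y j; simp [subMap, lengthProd_zero]
  | succ n ih =>
    intro y j
    simp only [subMap]
    rw [hq.stepMap_add, ih, lengthProd_succ]
    funext i
    push_cast
    ring_nf

theorem HasLengthSequence.subwordAt_stepMap (hq : θ.HasLengthSequence q) [∀ n, Nonempty (A n)]
    (n : ℕ) (y : ℤ → A (n + 1)) (j : ℤ) :
    subwordAt (θ.stepMap q n y) (q n * j) (q n) = θ.morphism n (y j) := by
  have hpos := hq.pos n
  apply List.ext_getElem
  · simp [subwordAt, hq n]
  · intro i h₁ h₂
    have hi : i < q n := by simpa [subwordAt] using h₁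
    have hdiv : ((q n : ℤ) * j + i) / q n = j := by
      rw [add_comm, Int.add_mul_ediv_left _ _ (by omega), Int.ediv_eq_zero_of_lt] <;> omega
    have hmod : ((q n : ℤ) * j + i) % q n = i := by
      rw [add_comm, Int.add_mul_emod_self_left, Int.emod_eq_of_lt] <;> omega
    have hlen : i < (θ.morphism n (y j)).length := by rwa [hq]
    simp only [subwordAt, List.getElem_ofFn]
    rw [stepMap, hdiv]
    exact θ.letterAt_eq_getElem n (y j) hlen (by rw [hq, hmod])

theorem HasLengthSequence.subwordAt_stepMap_mul (hq : θ.HasLengthSequence q)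
    [∀ n, Nonempty (A n)] (n : ℕ) (y : ℤ → A (n + 1)) (j : ℤ) (m : ℕ) :
    subwordAt (θ.stepMap q n y) (q n * j) (q n * m) =
      (subwordAt y j m).flatMap (θ.morphism n) := by
  induction m with
  | zero => simp [subwordAt_zero]
  | succ m ih =>
    rw [Nat.mul_succ, subwordAt_add, ih, subwordAt_add, List.flatMap_append]
    congr 1
    have : (q n : ℤ) * j + (q n * m : ℕ) = q n * (j + m) := by push_cast; ring
    rw [this, hq.subwordAt_stepMap]
    simp [subwordAt]

theorem HasLengthSequence.stepMap_mem_levelShift (hq : θ.HasLengthSequence q)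
    [∀ n, Nonempty (A n)] {n : ℕ} {y : ℤ → A (n + 1)} (hy : y ∈ θ.levelShift (n + 1)) :
    θ.stepMap q n y ∈ θ.levelShift n := by
  intro k m
  have hpos := hq.pos n
  -- The window starts inside the block of index `k / q n`, and since `q n ≥ 1` it is covered by `m
  -- + 1` blocks.
  have h := θ.flatMap_morphism_mem_language (hy (k / q n) (m + 1))
  rw [← hq.subwordAt_stepMap_mul] at h
  refine θ.mem_language_of_isInfix ?_ h
  have h0 := Int.emod_nonneg k (b := (q n : ℤ)) (by omega)
  have h1 := Int.emod_lt_of_pos k (b := (q n : ℤ)) (by omega)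
  have h2 := Int.mul_ediv_add_emod k (q n)
  obtain ⟨a, ha⟩ := Int.eq_ofNat_of_zero_le h0
  have haq : a < q n := by omega
  obtain ⟨c, hc⟩ : ∃ c, q n * (m + 1) = a + m + c := by
    apply Nat.exists_eq_add_of_le
    nlinarith
  have := subwordAt_isInfix (θ.stepMap q n y) (q n * (k / q n)) a m c
  rwa [← hc, show (q n : ℤ) * (k / q n) + a = k by omega] at this

theorem HasLengthSequence.subMap_mem_levelShift (hq : θ.HasLengthSequence q)
    [∀ n, Nonempty (A n)] (n : ℕ) :
    ∀ {y : ℤ → A n}, y ∈ θ.levelShift n → θ.subMap q n y ∈ θ.levelShift 0 := by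
  induction n with
  | zero => intro y hy; exact hy
  | succ n ih => intro y hy; exact ih (hq.stepMap_mem_levelShift hy)

theorem shiftMap_zpow_apply [∀ n, TopologicalSpace (A n)] (θ : DirectiveSequence A) (k : ℤ) :
    ∀ (x : θ.levelShift 0) (i : ℤ), ((θ.shiftMap ^ k) x).1 i = x.1 (i + k) := by
  have h1 : ∀ (x : θ.levelShift 0) (i : ℤ), (θ.shiftMap x).1 i = x.1 (i + 1) := fun _ _ => rfl
  induction k with
  | zero => intro x i; rw [Homeomorph.zpow_zero_apply, add_zero]
  | succ k ih =>
    intro x i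
    rw [Homeomorph.zpow_one_add_apply, h1, ih, add_right_comm, add_assoc]
  | pred k ih =>
    intro x i
    have := ih x (i - 1)
    rw [← sub_add_cancel (-(k : ℤ)) 1, Homeomorph.zpow_one_add_apply, h1,
      sub_add_cancel] at this
    rw [this]; ring_nf

section Topology

variable [∀ n, TopologicalSpace (A n)] [∀ n, DiscreteTopology (A n)]

theorem continuous_subMap (θ : DirectiveSequence A) (q : ℕ → ℕ) (n : ℕ) :
    Continuous (θ.subMap q n) := by
  induction n with
  | zero => exact continuous_id
  | succ n ih =>
    refine ih.comp (continuous_pi fun i => ?_)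
    exact (continuous_of_discreteTopology (f := fun a => θ.letterAt n a i)).comp
      (continuous_apply (i / (q n : ℤ)))

theorem isClosed_levelShift (θ : DirectiveSequence A) (n : ℕ) : IsClosed (θ.levelShift n) := by
  have : θ.levelShift n = ⋂ (k : ℤ) (m : ℕ), (fun x (i : Fin m) => x (k + i)) ⁻¹'
      {w | List.ofFn w ∈ θ.language n} := by
    ext x; simp [levelShift, subwordAt]
  rw [this]
  exact isClosed_iInter fun k => isClosed_iInter fun m =>
    (isClosed_discrete _).preimage (by fun_prop)

end Topology

end DirectiveSequence

/-! ### The sets B_n and the clopen partition by their translates -/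

namespace DirectiveSequence

section Blocks

variable {A : ℕ → Type u} [∀ n, TopologicalSpace (A n)] {θ : DirectiveSequence A} {q : ℕ → ℕ}

theorem add_mem_levelShift {A : ℕ → Type u} {θ : DirectiveSequence A} {n : ℕ} {x : ℤ → A n} (hx : x ∈ θ.levelShift n) (k : ℤ) :
    (fun i => x (i + k)) ∈ θ.levelShift n := by
  intro l m
  have := hx (l + k) m
  simp only [subwordAt] at this ⊢
  convert this using 4
  ring

theorem IsTorsionFree.nonempty (hθ : θ.IsTorsionFree q) (n : ℕ) : Nonempty (A n) := by
  obtain ⟨x, -⟩ := (hθ.isMinimalShift n).1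
  exact ⟨x 0⟩

theorem IsTorsionFree.nonempty_levelShift (hθ : θ.IsTorsionFree q) :
    Nonempty (θ.levelShift 0) :=
  (hθ.isMinimalShift 0).1.to_subtype

/-- The points of `X^{(0)}` that are images under `θ^{[0, n)}` of points of `X^{(n)}`. -/
def blockSet (θ : DirectiveSequence A) (q : ℕ → ℕ) (n : ℕ) : Set (θ.levelShift 0) :=
  {x | ∃ y ∈ θ.levelShift n, θ.subMap q n y = x.1}

theorem IsTorsionFree.nonempty_blockSet (hθ : θ.IsTorsionFree q) (n : ℕ) :
    (θ.blockSet q n).Nonempty := by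
  have := hθ.nonempty
  obtain ⟨y, hy⟩ := (hθ.isMinimalShift n).1
  exact ⟨⟨_, hθ.hasLengthSequence.subMap_mem_levelShift n hy⟩, y, hy, rfl⟩

theorem IsTorsionFree.zpow_mul_mem_blockSet (hθ : θ.IsTorsionFree q) (n : ℕ) (j : ℤ)
    {x : θ.levelShift 0} (hx : x ∈ θ.blockSet q n) :
    (θ.shiftMap ^ (lengthProd q n * j : ℤ)) x ∈ θ.blockSet q n := by
  have := hθ.nonempty
  obtain ⟨y, hy, hyx⟩ := hx
  refine ⟨_, add_mem_levelShift hy j, ?_⟩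
  rw [hθ.hasLengthSequence.subMap_add, hyx]
  funext i
  rw [shiftMap_zpow_apply]

theorem IsTorsionFree.zpow_mul_mem_blockSet_iff (hθ : θ.IsTorsionFree q) (n : ℕ) (j : ℤ)
    {x : θ.levelShift 0} :
    (θ.shiftMap ^ (lengthProd q n * j : ℤ)) x ∈ θ.blockSet q n ↔ x ∈ θ.blockSet q n := by
  refine ⟨fun h => ?_, hθ.zpow_mul_mem_blockSet n j⟩
  have := hθ.zpow_mul_mem_blockSet n (-j) h
  rwa [mul_neg, Homeomorph.zpow_neg_apply_zpow] at this

theorem IsTorsionFree.zpow_emod_mem_blockSet_iff (hθ : θ.IsTorsionFree q) (n : ℕ) (k : ℤ)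
    {x : θ.levelShift 0} :
    (θ.shiftMap ^ (k % lengthProd q n)) x ∈ θ.blockSet q n ↔
      (θ.shiftMap ^ k) x ∈ θ.blockSet q n := by
  conv_rhs => rw [← Int.mul_ediv_add_emod k (lengthProd q n), Homeomorph.zpow_add_apply]
  rw [hθ.zpow_mul_mem_blockSet_iff]

theorem IsTorsionFree.isMinimalSystem (hθ : θ.IsTorsionFree q)
    [∀ n, Finite (A n)] [∀ n, DiscreteTopology (A n)] : IsMinimalSystem θ.shiftMap := by
  intro C hC hinv
  have hval : Topology.IsClosedEmbedding (Subtype.val : θ.levelShift 0 → ℤ → A 0) :=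
    (θ.isClosed_levelShift 0).isClosedEmbedding_subtypeVal
  have hsub : Subtype.val '' C ⊆ θ.levelShift 0 := by rintro _ ⟨x, -, rfl⟩; exact x.2
  rcases (hθ.isMinimalShift 0).2 (Subtype.val '' C) hsub (hval.isClosedMap C hC) (by
    ext y
    constructor
    · rintro ⟨_, ⟨x, hx, rfl⟩, rfl⟩
      exact ⟨θ.shiftMap x, (hinv x).2 hx, rfl⟩
    · rintro ⟨x, hx, rfl⟩
      refine ⟨_, ⟨θ.shiftMap.symm x, ?_, rfl⟩, ?_⟩
      · rw [← hinv, θ.shiftMap.apply_symm_apply]; exact hx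
      · exact congrArg Subtype.val (θ.shiftMap.apply_symm_apply x)) with h | h
  · left; exact Set.image_eq_empty.1 h
  · right
    ext x
    simp only [Set.mem_univ, iff_true]
    obtain ⟨y, hy, hyx⟩ := h.symm.subset x.2
    rwa [← Subtype.ext hyx]

variable [∀ n, Finite (A n)] [∀ n, DiscreteTopology (A n)]

theorem isCompact_levelShift (θ : DirectiveSequence A) (n : ℕ) : IsCompact (θ.levelShift n) :=
  (θ.isClosed_levelShift n).isCompact

instance compactSpace_levelShift (θ : DirectiveSequence A) (n : ℕ) :
    CompactSpace (θ.levelShift n) :=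
  isCompact_iff_compactSpace.1 (θ.isCompact_levelShift n)

theorem isClosed_blockSet (θ : DirectiveSequence A) (q : ℕ → ℕ) (n : ℕ) :
    IsClosed (θ.blockSet q n) :=
  ((θ.isCompact_levelShift n).image (θ.continuous_subMap q n)).isClosed.preimage
    continuous_subtype_val

/-- Invariance of B_n under σ^{p_n} leaves only p_n translates, so their union is closed as well as
invariant, and minimality applies. -/
theorem IsTorsionFree.exists_zpow_mem_blockSet (hθ : θ.IsTorsionFree q) (n : ℕ)
    (x : θ.levelShift 0) : ∃ k : ℤ, (θ.shiftMap ^ k) x ∈ θ.blockSet q n := by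
  have := hθ.nonempty
  have hpos := hθ.hasLengthSequence.lengthProd_pos n
  let C : Set (θ.levelShift 0) :=
    ⋃ k ∈ Finset.range (lengthProd q n), (θ.shiftMap ^ (k : ℤ)) ⁻¹' θ.blockSet q n
  have hC : IsClosed C := isClosed_biUnion_finset fun k _ =>
    (θ.isClosed_blockSet q n).preimage (θ.shiftMap ^ (k : ℤ)).continuous
  have hmem : ∀ y, y ∈ C ↔ ∃ k : ℤ, (θ.shiftMap ^ k) y ∈ θ.blockSet q n := by
    intro y
    simp only [C, Set.mem_iUnion, Set.mem_preimage, Finset.mem_range, exists_prop]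
    constructor
    · rintro ⟨k, -, h⟩; exact ⟨k, h⟩
    · rintro ⟨k, h⟩
      have h0 := Int.emod_nonneg k (b := (lengthProd q n : ℤ)) (by omega)
      have h1 := Int.emod_lt_of_pos k (b := (lengthProd q n : ℤ)) (by omega)
      refine ⟨(k % lengthProd q n).toNat, by omega, ?_⟩
      rwa [Int.toNat_of_nonneg h0, hθ.zpow_emod_mem_blockSet_iff]
  rw [← hmem]
  rcases hθ.isMinimalSystem C hC (fun y => by
    rw [hmem, hmem]
    constructor
    · rintro ⟨k, h⟩; exact ⟨k + 1, by rwa [Homeomorph.zpow_apply_apply]⟩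
    · rintro ⟨k, h⟩
      exact ⟨k - 1, by rwa [← Homeomorph.zpow_apply_apply, sub_add_cancel]⟩) with h | h
  · obtain ⟨b, hb⟩ := hθ.nonempty_blockSet n
    have : b ∈ C := (hmem b).2 ⟨0, by rwa [Homeomorph.zpow_zero_apply]⟩
    rw [h] at this
    exact this.elim
  · rw [h]; trivial

omit [∀ n, Finite (A n)] in
/-- The set of images under `θ^{[0, n)}` is minimal for the power `p n` of the shift. -/
theorem IsTorsionFree.blockSet_subset (hθ : θ.IsTorsionFree q) (n : ℕ)
    {D : Set (θ.levelShift 0)} (hD : IsClosed D)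
    (hinv : ∀ x, (θ.shiftMap ^ (lengthProd q n : ℤ)) x ∈ D ↔ x ∈ D)
    (hne : (θ.blockSet q n ∩ D).Nonempty) : θ.blockSet q n ⊆ D := by
  have := hθ.nonempty
  let f : (ℤ → A n) → ℤ → A 0 := θ.subMap q n
  -- Pulled back to X^{(n)}, the power σ^{p_n} becomes the shift, so minimality of X^{(n)} applies
  -- to `E`.
  let E : Set (ℤ → A n) := θ.levelShift n ∩ f ⁻¹' (Subtype.val '' D)
  have hval : Topology.IsClosedEmbedding (Subtype.val : θ.levelShift 0 → ℤ → A 0) :=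
    (θ.isClosed_levelShift 0).isClosedEmbedding_subtypeVal
  have hE : IsClosed E := (θ.isClosed_levelShift n).inter
    ((hval.isClosedMap D hD).preimage (θ.continuous_subMap q n))
  have hmem : ∀ (y) (hy : y ∈ θ.levelShift n), y ∈ E ↔
      (⟨f y, hθ.hasLengthSequence.subMap_mem_levelShift n hy⟩ : θ.levelShift 0) ∈ D := by
    intro y hy
    constructor
    · rintro ⟨-, x, hx, hxy⟩
      convert hx
      exact hxy.symm
    · intro h; exact ⟨hy, _, h, rfl⟩
  have hshift : ∀ y ∈ θ.levelShift n, leftShift (A n) y ∈ E ↔ y ∈ E := by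
    intro y hy
    rw [hmem _ ((θ.mem_levelShift_iff n y).1 hy), hmem y hy,
      ← hinv ⟨f y, hθ.hasLengthSequence.subMap_mem_levelShift n hy⟩]
    have : f (leftShift (A n) y) = fun i => f y (i + lengthProd q n * 1) :=
      hθ.hasLengthSequence.subMap_add n y 1
    rw [mul_one] at this
    convert Iff.rfl using 2
    apply Subtype.ext
    funext i
    rw [shiftMap_zpow_apply]
    exact (congrFun this i).symm
  rcases (hθ.isMinimalShift n).2 E Set.inter_subset_left hE (by
    ext y
    constructor
    · rintro ⟨x, hx, rfl⟩; exact (hshift x hx.1).2 hx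
    · intro hy
      have h := (leftShift (A n)).apply_symm_apply y
      have hy' : (leftShift (A n)).symm y ∈ θ.levelShift n := by
        rw [θ.mem_levelShift_iff, h]; exact hy.1
      exact ⟨_, (hshift _ hy').1 (by rwa [h]), h⟩) with h | h
  · obtain ⟨x, ⟨y, hy, hyx⟩, hx⟩ := hne
    have : y ∈ E := ⟨hy, x, hx, hyx.symm⟩
    rw [h] at this
    exact this.elim
  · rintro x ⟨y, hy, hyx⟩
    have : y ∈ E := by rw [h]; exact hy
    rw [hmem y hy] at this
    convert this
    exact hyx.symm

/-- A translate of B_n is closed and σ^{p_n}-invariant, so it contains B_n once it meets it. Hence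
translates are equal or disjoint. -/
theorem IsTorsionFree.zpow_mem_blockSet_iff (hθ : θ.IsTorsionFree q) (n : ℕ) (k : ℤ)
    {x y : θ.levelShift 0} (hx : x ∈ θ.blockSet q n) (hy : y ∈ θ.blockSet q n) :
    (θ.shiftMap ^ k) x ∈ θ.blockSet q n ↔ (θ.shiftMap ^ k) y ∈ θ.blockSet q n := by
  have key : ∀ {x y : θ.levelShift 0}, x ∈ θ.blockSet q n → y ∈ θ.blockSet q n →
      (θ.shiftMap ^ k) x ∈ θ.blockSet q n → (θ.shiftMap ^ k) y ∈ θ.blockSet q n := by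
    intro x y hx hy h
    refine hθ.blockSet_subset n (D := (θ.shiftMap ^ k) ⁻¹' θ.blockSet q n)
      ((θ.isClosed_blockSet q n).preimage (θ.shiftMap ^ k).continuous) (fun z => ?_)
      ⟨x, hx, h⟩ hy
    rw [Set.mem_preimage, Set.mem_preimage, ← Homeomorph.zpow_add_apply, add_comm,
      Homeomorph.zpow_add_apply]
    have := hθ.zpow_mul_mem_blockSet_iff n 1 (x := (θ.shiftMap ^ k) z)
    rwa [mul_one] at this
  exact ⟨key hx hy, key hy hx⟩

/-- The complement is the union of the finitely many translates disjoint from B_n, which are closed.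
-/
theorem IsTorsionFree.isOpen_blockSet (hθ : θ.IsTorsionFree q) (n : ℕ) :
    IsOpen (θ.blockSet q n) := by
  classical
  have := hθ.nonempty
  have hpos := hθ.hasLengthSequence.lengthProd_pos n
  obtain ⟨b, hb⟩ := hθ.nonempty_blockSet n
  have : (θ.blockSet q n)ᶜ = ⋃ k ∈ (Finset.range (lengthProd q n)).filter
      (fun k : ℕ => (θ.shiftMap ^ (-(k : ℤ))) b ∉ θ.blockSet q n),
      (θ.shiftMap ^ (k : ℤ)) ⁻¹' θ.blockSet q n := by
    ext x
    simp only [Set.mem_compl_iff, Finset.mem_filter, Set.mem_iUnion,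
      Set.mem_preimage, exists_prop]
    constructor
    · intro hx
      obtain ⟨k, hk⟩ := hθ.exists_zpow_mem_blockSet n x
      have h0 := Int.emod_nonneg k (b := (lengthProd q n : ℤ)) (by omega)
      have h1 := Int.emod_lt_of_pos k (b := (lengthProd q n : ℤ)) (by omega)
      rw [← hθ.zpow_emod_mem_blockSet_iff] at hk
      lift k % (lengthProd q n : ℤ) to ℕ using h0 with r
      refine ⟨r, ⟨Finset.mem_range.2 (by omega), fun h => hx ?_⟩, hk⟩
      rw [hθ.zpow_mem_blockSet_iff n _ hb hk, Homeomorph.zpow_neg_apply_zpow] at h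
      exact h
    · rintro ⟨k, ⟨-, hk⟩, hx⟩ h
      rw [hθ.zpow_mem_blockSet_iff n _ hb hx, Homeomorph.zpow_neg_apply_zpow] at hk
      exact hk h
  rw [← isClosed_compl_iff, this]
  exact isClosed_biUnion_finset fun k _ =>
    (θ.isClosed_blockSet q n).preimage (θ.shiftMap ^ (k : ℤ)).continuous

/-- The cyclic factor whose fibres are the distinct translates of the set of images under
`θ^{[0, n)}`. -/
theorem IsTorsionFree.exists_isCyclicFactor_blockSet (hθ : θ.IsTorsionFree q) (n : ℕ) :
    ∃ (c : ℕ) (g : θ.levelShift 0 → ZMod c), 0 < c ∧ c ∣ lengthProd q n ∧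
      IsCyclicFactor θ.shiftMap c g ∧
      ∀ b ∈ θ.blockSet q n, ∀ x, g x = g b ↔ x ∈ θ.blockSet q n := by
  have := hθ.nonempty_levelShift
  -- Lying in the same translates; by `hclass` one common translate suffices, so the classes are
  -- exactly the translates.
  let s : Setoid (θ.levelShift 0) :=
    { r := fun x y => ∀ k : ℤ, (θ.shiftMap ^ k) x ∈ θ.blockSet q n ↔
        (θ.shiftMap ^ k) y ∈ θ.blockSet q n
      iseqv := ⟨fun _ _ => Iff.rfl, fun h k => (h k).symm, fun h h' k => (h k).trans (h' k)⟩ }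
  have hclass : ∀ (j : ℤ) (x y : θ.levelShift 0), (θ.shiftMap ^ j) x ∈ θ.blockSet q n →
      (s x y ↔ (θ.shiftMap ^ j) y ∈ θ.blockSet q n) := by
    intro j x y hx
    refine ⟨fun h => (h j).1 hx, fun h k => ?_⟩
    have := hθ.zpow_mem_blockSet_iff n (k - j) hx h
    rwa [← Homeomorph.zpow_add_apply, ← Homeomorph.zpow_add_apply, sub_add_cancel] at this
  obtain ⟨c, g, hc, hg, hker⟩ := hθ.isMinimalSystem.exists_isCyclicFactor_of_setoid s
    (fun x y => ⟨fun h k => by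
        have := h (k - 1)
        rwa [← Homeomorph.zpow_apply_apply, ← Homeomorph.zpow_apply_apply, sub_add_cancel] at this,
      fun h k => by
        rw [← Homeomorph.zpow_apply_apply, ← Homeomorph.zpow_apply_apply]; exact h (k + 1)⟩)
    (fun x => by
      obtain ⟨j, hj⟩ := hθ.exists_zpow_mem_blockSet n x
      have : {y | s x y} = (θ.shiftMap ^ j) ⁻¹' θ.blockSet q n := by
        ext y; exact hclass j x y hj
      rw [this]
      exact (hθ.isOpen_blockSet n).preimage (θ.shiftMap ^ j).continuous)
  have hb' : ∀ b ∈ θ.blockSet q n, ∀ x, g x = g b ↔ x ∈ θ.blockSet q n := by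
    intro b hb x
    rw [eq_comm, hker, hclass 0 b x (by rwa [Homeomorph.zpow_zero_apply]),
      Homeomorph.zpow_zero_apply]
  refine ⟨c, g, hc, ?_, hg, hb'⟩
  obtain ⟨b, hb⟩ := hθ.nonempty_blockSet n
  have h := (hb' b hb _).2 (hθ.zpow_mul_mem_blockSet n 1 hb)
  rw [hg.map_zpow, add_eq_left, mul_one, Int.cast_natCast, ZMod.natCast_eq_zero_iff] at h
  exact h

/-- The number of translates of the set of images under `θ^{[0, n)}` is at least `p n / K` when
the alphabets have at most `K` letters. -/
theorem IsTorsionFree.exists_isCyclicFactor_mul_eq (hθ : θ.IsTorsionFree q) {K : ℕ}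
    (hK : ∀ n, Nat.card (A n) ≤ K) (n : ℕ) :
    ∃ (c d : ℕ) (g : θ.levelShift 0 → ZMod c), c * d = lengthProd q n ∧ d ≤ K ∧
      IsCyclicFactor θ.shiftMap c g := by
  have := hθ.nonempty
  have hpos := hθ.hasLengthSequence.lengthProd_pos n
  obtain ⟨c, g, hc, ⟨d, hd⟩, hg, hb⟩ := hθ.exists_isCyclicFactor_blockSet n
  refine ⟨c, d, g, hd.symm, ?_, hg⟩
  have hd0 : 0 < d := by
    rcases Nat.eq_zero_or_pos d with h | h
    · rw [h, mul_zero] at hd; omega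
    · exact h
  obtain ⟨b, hbB⟩ := hθ.nonempty_blockSet n
  -- A point at offset t < c from B_n has its first p_n - c letters inside one block. They depend
  -- only on t and the letter `y 0`, which is why a constant sequence can replace `y`.
  have hcover : wordsOfLength (θ.levelShift 0) (lengthProd q n - c) ⊆
      Set.range (fun (r : Fin c × A n) (i : Fin (lengthProd q n - c)) =>
        θ.subMap q n (fun _ => r.2) ((r.1 : ℕ) + (i : ℕ) : ℤ)) := by
    rintro _ ⟨x, hx, rfl⟩
    have : NeZero c := ⟨hc.ne'⟩
    let t : ℕ := (g ⟨x, hx⟩ - g b).val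
    have ht : t < c := ZMod.val_lt _
    have hxB : (θ.shiftMap ^ (-(t : ℤ))) ⟨x, hx⟩ ∈ θ.blockSet q n := by
      rw [← hb b hbB, hg.map_zpow]
      simp [t]
    obtain ⟨y, hy, hyx⟩ := hxB
    refine ⟨(⟨t, ht⟩, y 0), ?_⟩
    funext i
    have hdiv : ((t : ℤ) + (i : ℕ)) / lengthProd q n = 0 := by
      have := i.2
      apply Int.ediv_eq_zero_of_lt <;> omega
    have h1 : θ.subMap q n y ((t : ℤ) + (i : ℕ)) = x (i : ℕ) := by
      rw [hyx, shiftMap_zpow_apply, add_right_comm, add_neg_cancel, zero_add]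
    simp only
    rw [← h1]
    apply subMap_apply_congr
    rw [hdiv]
  have hcard : (wordsOfLength (θ.levelShift 0) (lengthProd q n - c)).ncard ≤ c * K := by
    refine (Set.ncard_le_ncard hcover (Set.toFinite _)).trans ?_
    rw [← Set.image_univ]
    refine (Set.ncard_image_le (Set.toFinite _)).trans ?_
    rw [Set.ncard_univ, Nat.card_prod, Nat.card_eq_fintype_card, Fintype.card_fin]
    exact Nat.mul_le_mul_left _ (hK n)
  have hMH : lengthProd q n - c <
      (wordsOfLength (θ.levelShift 0) (lengthProd q n - c)).ncard := by
    by_contra! hle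
    obtain ⟨k, hk, hper⟩ := exists_periodic_of_ncard_wordsOfLength_le
      (fun x hx k => add_mem_levelShift hx k) hle b.2
    refine hθ.isAperiodicShift b.1 b.2 k hk ?_
    have : ∀ (j : ℕ) (x : ℤ → A 0), (leftShift (A 0))^[j] x = fun i => x (i + j) := by
      intro j
      induction j with
      | zero => intro x; simp
      | succ j ih =>
        intro x
        rw [Function.iterate_succ_apply, ih]
        funext i
        change x (i + j + 1) = _
        push_cast; rw [add_assoc]
    rw [this]
    exact funext hper
  -- The two counts combine to p_n - c < c K.
  have hlt : c * d < c * (K + 1) := by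
    rw [← hd, Nat.mul_succ]; omega
  have := Nat.lt_of_mul_lt_mul_left hlt
  omega

end Blocks

end DirectiveSequence

/-! ### Divisibility of the products of lengths -/

section LengthProd

variable {q : ℕ → ℕ}

theorem lengthProd_dvd {m n : ℕ} (h : m ≤ n) : lengthProd q m ∣ lengthProd q n := by
  induction n, h using Nat.le_induction with
  | base => exact dvd_rfl
  | succ n _ ih => exact ih.trans (lengthProd_dvd_succ q n)

theorem exists_lt_lengthProd (hq : ∀ n, 0 < q n) (hf : ∃ᶠ n in atTop, 1 < q n) (R : ℕ) :
    ∃ n, R < lengthProd q n := by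
  have hpos : ∀ n, 0 < lengthProd q n := fun n => Finset.prod_pos fun i _ => hq i
  induction R with
  | zero => exact ⟨0, hpos 0⟩
  | succ R ih =>
    obtain ⟨n, hn⟩ := ih
    obtain ⟨m, hm, hqm⟩ := frequently_atTop.1 hf n
    refine ⟨m + 1, ?_⟩
    rw [lengthProd_succ]
    have := Nat.le_of_dvd (hpos m) (lengthProd_dvd (q := q) hm)
    nlinarith

theorem exists_pow_dvd_lengthProd {p : ℕ} (hf : ∃ᶠ n in atTop, p ∣ q n) (a : ℕ) :
    ∃ n, p ^ a ∣ lengthProd q n := by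
  induction a with
  | zero => exact ⟨0, by simp⟩
  | succ a ih =>
    obtain ⟨n, hn⟩ := ih
    obtain ⟨m, hm, hqm⟩ := frequently_atTop.1 hf n
    refine ⟨m + 1, ?_⟩
    rw [lengthProd_succ, pow_succ]
    exact mul_dvd_mul (hn.trans (lengthProd_dvd hm)) hqm

theorem exists_dvd_of_prime_dvd_lengthProd {p n : ℕ} (hp : p.Prime) (h : p ∣ lengthProd q n) :
    ∃ k, p ∣ q k := by
  obtain ⟨k, -, hk⟩ := (hp.prime.dvd_finsetProd_iff _).1 h
  exact ⟨k, hk⟩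

theorem coprime_lengthProd {h : ℕ} (hh : ∀ n, h.Coprime (q n)) (n : ℕ) :
    h.Coprime (lengthProd q n) :=
  Nat.Coprime.prod_right fun i _ => hh i

/-- The part of p^(a+K) absorbed by `d` is some p^j ≤ K, so j < p^j ≤ K and fewer than K factors p
are lost. -/
theorem pow_dvd_left_of_pow_add_dvd_mul {p a K c d : ℕ} (hp : p.Prime)
    (h : p ^ (a + K) ∣ c * d) (hd0 : 0 < d) (hd : d ≤ K) : p ^ a ∣ c := by
  obtain ⟨x, y, hx, hy, hxy⟩ := (Nat.dvd_mul).1 h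
  obtain ⟨i, -, rfl⟩ := (Nat.dvd_prime_pow hp).1 ⟨y, hxy.symm⟩
  obtain ⟨j, -, rfl⟩ := (Nat.dvd_prime_pow hp).1 ⟨p ^ i, by rw [← hxy, mul_comm]⟩
  have hij : i + j = a + K := Nat.pow_right_injective hp.two_le (by simpa [pow_add] using hxy)
  have hj : j < K := by
    have h1 := Nat.le_of_dvd hd0 hy
    have h2 := Nat.lt_pow_self hp.one_lt (n := j)
    omega
  exact (pow_dvd_pow p (by omega)).trans hx

end LengthProd

namespace DirectiveSequence

section Cyclic

variable {A : ℕ → Type u} [∀ n, TopologicalSpace (A n)] {θ : DirectiveSequence A} {q : ℕ → ℕ}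
  [∀ n, Finite (A n)] [∀ n, DiscreteTopology (A n)]

/-! ### Finite cyclic factors of torsion-free shifts -/

/-- For p^a, go down to a level with p^(a+K) dividing p_n: the order c found there misses only a
cofactor at most K, so p^a still divides c. Coprime orders are glued by the Chinese remainder
theorem. -/
theorem IsTorsionFree.exists_isCyclicFactor_of_primes (hθ : θ.IsTorsionFree q) {K : ℕ}
    (hK : ∀ n, Nat.card (A n) ≤ K) (m : ℕ) (hm : m ≠ 0)
    (hp : ∀ p, p.Prime → p ∣ m → ∃ k, p ∣ q k) :
    ∃ g : θ.levelShift 0 → ZMod m, IsCyclicFactor θ.shiftMap m g := by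
  have := hθ.nonempty
  induction m using Nat.recOnPosPrimePosCoprime with
  | zero => exact absurd rfl hm
  | one =>
    exact ⟨fun _ => 0, IsLocallyConstant.const _, fun _ => Subsingleton.elim _ _⟩
  | prime_pow p a hpp ha =>
    obtain ⟨k, hk⟩ := hp p hpp (dvd_pow_self p ha.ne')
    obtain ⟨n, hn⟩ := exists_pow_dvd_lengthProd (hθ.frequently_dvd p hpp k hk) (a + K)
    obtain ⟨c, d, g, hcd, hd, hg⟩ := hθ.exists_isCyclicFactor_mul_eq hK n
    have hpos := hθ.hasLengthSequence.lengthProd_pos n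
    have hd0 : 0 < d := Nat.pos_of_ne_zero (by rintro rfl; simp at hcd; omega)
    rw [← hcd] at hn
    exact ⟨_, hg.castHom (pow_dvd_left_of_pow_add_dvd_mul hpp hn hd0 hd)⟩
  | coprime a b ha hb hab iha ihb =>
    obtain ⟨f, hf⟩ := iha (by omega) fun p hpp h => hp p hpp (h.mul_right b)
    obtain ⟨g, hg⟩ := ihb (by omega) fun p hpp h => hp p hpp (h.mul_left a)
    exact ⟨_, hf.chineseRemainder hg hab⟩

theorem IsTorsionFree.exists_isCyclicFactor_lengthProd (hθ : θ.IsTorsionFree q) {K : ℕ}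
    (hK : ∀ n, Nat.card (A n) ≤ K) (n : ℕ) :
    ∃ g : θ.levelShift 0 → ZMod (lengthProd q n), IsCyclicFactor θ.shiftMap (lengthProd q n) g :=
  have := hθ.nonempty
  hθ.exists_isCyclicFactor_of_primes hK _ (hθ.hasLengthSequence.lengthProd_pos n).ne'
    fun _ hp h => exists_dvd_of_prime_dvd_lengthProd hp h

/-! ### Fibres of the cyclic factor of order p_n, and windows -/

variable {n : ℕ} {g : θ.levelShift 0 → ZMod (lengthProd q n)}

/-- The fibre of `g` is closed and σ^{p_n}-invariant, so it contains B_n. If σ^k x lies in B_n,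
comparing values of `g` gives p_n ∣ k, and B_n is invariant under such a power. -/
theorem IsTorsionFree.mem_blockSet_of_eq (hθ : θ.IsTorsionFree q)
    (hg : IsCyclicFactor θ.shiftMap (lengthProd q n) g) {b x : θ.levelShift 0}
    (hb : b ∈ θ.blockSet q n) (hx : g x = g b) : x ∈ θ.blockSet q n := by
  obtain ⟨k, hk⟩ := hθ.exists_zpow_mem_blockSet n x
  have hsub := hθ.blockSet_subset n (hg.isLocallyConstant.isClosed_fiber (g b))
    (fun z => by
      change g _ = g b ↔ g z = g b
      rw [hg.map_zpow]
      simp) ⟨b, hb, rfl⟩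
  have hkb : g ((θ.shiftMap ^ k) x) = g b := hsub hk
  rw [hg.map_zpow, hx, add_eq_left, ZMod.intCast_zmod_eq_zero_iff_dvd] at hkb
  obtain ⟨j, rfl⟩ := hkb
  exact (hθ.zpow_mul_mem_blockSet_iff n j).1 hk

/-- On a fibre of the cyclic factor of order `p n`, a long window of the sequence is determined by
a single letter of the alphabet `A n`. -/
theorem IsTorsionFree.exists_label (hθ : θ.IsTorsionFree q)
    (hg : IsCyclicFactor θ.shiftMap (lengthProd q n) g) {r : ℕ} (hr : 2 * r + 1 ≤ lengthProd q n)
    (x : θ.levelShift 0) :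
    ∃ (k : ℤ) (l : {u // g u = g x} → A n), ∀ u v, l u = l v → ∀ i ∈ Finset.Icc (-r : ℤ) r,
      ((θ.shiftMap ^ k) u.1).1 i = ((θ.shiftMap ^ k) v.1).1 i := by
  obtain ⟨j, hj⟩ := hθ.exists_zpow_mem_blockSet n x
  have hB : ∀ u : {u // g u = g x}, ∃ y ∈ θ.levelShift n,
      θ.subMap q n y = ((θ.shiftMap ^ j) u.1).1 := fun u =>
    hθ.mem_blockSet_of_eq hg hj (by rw [hg.map_zpow, hg.map_zpow, u.2])
  choose y _ hy using hB
  -- The power `j` moves the fibre into B_n; the extra `r` moves the window [-r, r] to the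
  -- coordinates 0, …, 2r, inside block 0.
  refine ⟨r + j, fun u => y u 0, fun u v huv i hi => ?_⟩
  rw [Finset.mem_Icc] at hi
  rw [Homeomorph.zpow_add_apply, Homeomorph.zpow_add_apply, shiftMap_zpow_apply,
    shiftMap_zpow_apply _ (r : ℤ), ← hy, ← hy]
  apply subMap_apply_congr
  have : (i + r) / (lengthProd q n : ℤ) = 0 := by
    apply Int.ediv_eq_zero_of_lt <;> omega
  rw [this]
  exact huv

theorem exists_window_of_mem_nhds {A : ℕ → Type u} [∀ n, TopologicalSpace (A n)]
    {θ : DirectiveSequence A} {u : θ.levelShift 0} {s : Set (θ.levelShift 0)}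
    (hs : s ∈ nhds u) :
    ∃ r : ℕ, ∀ v : θ.levelShift 0, (∀ i ∈ Finset.Icc (-r : ℤ) r, v.1 i = u.1 i) → v ∈ s := by
  rw [nhds_subtype_eq_comap, Filter.mem_comap] at hs
  obtain ⟨t, ht, hts⟩ := hs
  rw [nhds_pi, Filter.mem_pi] at ht
  obtain ⟨I, hI, t', ht', hIt⟩ := ht
  refine ⟨hI.toFinset.sup Int.natAbs, fun v hv => hts (hIt fun i hi => ?_)⟩
  have hle : i.natAbs ≤ hI.toFinset.sup Int.natAbs :=
    Finset.le_sup (f := Int.natAbs) (hI.mem_toFinset.2 hi)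
  rw [hv i (by rw [Finset.mem_Icc]; omega)]
  exact mem_of_mem_nhds (ht' i)

/-- A uniform window for a family of neighbourhoods. -/
theorem exists_uniform_window {R : θ.levelShift 0 → θ.levelShift 0 → Prop}
    (hR : ∀ u, ∀ᶠ v in nhds u, R u v) :
    ∃ r : ℕ, ∀ v v' : θ.levelShift 0, (∀ i ∈ Finset.Icc (-r : ℤ) r, v.1 i = v'.1 i) →
      ∃ u, R u v ∧ R u v' := by
  choose r hr using fun u => exists_window_of_mem_nhds (hR u)
  let U : θ.levelShift 0 → Set (θ.levelShift 0) := fun u =>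
    ⋂ i ∈ Finset.Icc (-(r u) : ℤ) (r u), {v | v.1 i = u.1 i}
  have hU : ∀ u, IsOpen (U u) := fun u => isOpen_biInter_finset fun i _ =>
    (isOpen_discrete ({u.1 i} : Set (A 0))).preimage ((continuous_apply (A := fun _ : ℤ => A 0) i).comp
      (continuous_subtype_val (p := (· ∈ θ.levelShift 0))))
  obtain ⟨t, ht⟩ := isCompact_univ.elim_finite_subcover U hU
    (fun u _ => Set.mem_iUnion.2 ⟨u, by simp [U]⟩)
  refine ⟨t.sup r, fun v v' hv => ?_⟩
  have := ht (Set.mem_univ v)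
  simp only [Set.mem_iUnion, exists_prop] at this
  obtain ⟨u, hut, hu⟩ := this
  have hu' : ∀ i ∈ Finset.Icc (-(r u) : ℤ) (r u), v.1 i = u.1 i := by
    simpa only [U, Set.mem_iInter, Set.mem_ofPred_eq] using hu
  have hle : r u ≤ t.sup r := Finset.le_sup hut
  refine ⟨u, hr u v hu', hr u v' fun i hi => ?_⟩
  rw [← hu' i hi, hv i]
  rw [Finset.mem_Icc] at hi ⊢
  omega

theorem IsTorsionFree.exists_le_lengthProd {A : ℕ → Type u} [∀ n, TopologicalSpace (A n)]
    {θ : DirectiveSequence A} (hθ : θ.IsTorsionFree q) (R : ℕ) :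
    ∃ n, R ≤ lengthProd q n := by
  have := hθ.nonempty
  obtain ⟨n, hn⟩ := exists_lt_lengthProd hθ.hasLengthSequence.pos hθ.frequently_one_lt R
  exact ⟨n, hn.le⟩

/-- The orders of the cyclic factors that are coprime to the lengths are bounded. -/
theorem IsTorsionFree.isCyclicFactor_le (hθ : θ.IsTorsionFree q) {K : ℕ}
    (hK : ∀ n, Nat.card (A n) ≤ K) {m : ℕ} (hm : m ≠ 0) (hcop : ∀ n, m.Coprime (q n))
    {f : θ.levelShift 0 → ZMod m} (hf : IsCyclicFactor θ.shiftMap m f) : m ≤ K := by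
  obtain ⟨r, hr⟩ := exists_uniform_window (R := fun u v => f v = f u)
    (fun u => (IsLocallyConstant.iff_eventually_eq f).1 hf.isLocallyConstant u)
  obtain ⟨n, hn⟩ := hθ.exists_le_lengthProd (2 * r + 1)
  obtain ⟨g, hg⟩ := hθ.exists_isCyclicFactor_lengthProd hK n
  obtain ⟨x⟩ := hθ.nonempty_levelShift
  obtain ⟨k, l, hl⟩ := hθ.exists_label hg hn x
  have : NeZero m := ⟨hm⟩
  -- These points stay in one fibre of `g`, yet `f` separates them because p_n is a unit mod `m`. As
  -- the window determines `f`, their letters are distinct.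
  let w : ZMod m → {u // g u = g x} := fun a =>
    ⟨(θ.shiftMap ^ (lengthProd q n * (a.val : ℤ) : ℤ)) x, by rw [hg.map_zpow]; simp⟩
  have hinj : Function.Injective fun a => l (w a) := by
    intro a b hab
    obtain ⟨u, hu, hu'⟩ := hr _ _ (hl _ _ hab)
    have h := hu.trans hu'.symm
    simp only [w, hf.map_zpow] at h
    have hunit : IsUnit ((lengthProd q n : ℕ) : ZMod m) :=
      (ZMod.isUnit_iff_coprime _ _).2 (coprime_lengthProd hcop n).symm
    have h' := add_left_cancel (add_right_cancel h)
    push_cast at h'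
    rw [ZMod.natCast_zmod_val, ZMod.natCast_zmod_val] at h'
    exact hunit.mul_left_cancel h'
  calc m = Nat.card (ZMod m) := (Nat.card_zmod m).symm
    _ ≤ Nat.card (A n) := Nat.card_le_card_of_injective _ hinj
    _ ≤ K := hK n

/-- There is a largest order of the cyclic factors coprime to the lengths; together with the
products of lengths it controls all the cyclic factors. -/
theorem IsTorsionFree.exists_height (hθ : θ.IsTorsionFree q) {K : ℕ}
    (hK : ∀ n, Nat.card (A n) ≤ K) :
    ∃ h : ℕ, 0 < h ∧ (∀ n, h.Coprime (q n)) ∧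
      (∃ f : θ.levelShift 0 → ZMod h, IsCyclicFactor θ.shiftMap h f) ∧
      ∀ m : ℕ, m ≠ 0 → (∀ n, m.Coprime (q n)) →
        (∃ f : θ.levelShift 0 → ZMod m, IsCyclicFactor θ.shiftMap m f) → m ∣ h := by
  let S : Set ℕ := {m | m ≠ 0 ∧ (∀ n, m.Coprime (q n)) ∧
    ∃ f : θ.levelShift 0 → ZMod m, IsCyclicFactor θ.shiftMap m f}
  have hne : S.Nonempty := ⟨1, one_ne_zero, fun n => Nat.coprime_one_left _,
    fun _ => 0, IsLocallyConstant.const _, fun _ => Subsingleton.elim _ _⟩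
  have hbdd : BddAbove S := ⟨K, fun m ⟨hm, hcop, f, hf⟩ => hθ.isCyclicFactor_le hK hm hcop hf⟩
  obtain ⟨hh, hcop, f, hf⟩ := Nat.sSup_mem hne hbdd
  refine ⟨sSup S, Nat.pos_of_ne_zero hh, hcop, ⟨f, hf⟩, ?_⟩
  rintro m hm hmcop ⟨f', hf'⟩
  -- The lcm splits into coprime divisors of the two orders, so it is again an admissible order;
  -- maximality then forces it to equal `sSup S`.
  have hlcm : m.lcm (sSup S) ∈ S := by
    refine ⟨Nat.lcm_ne_zero hm hh, fun n => ?_, ?_⟩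
    · exact Nat.Coprime.coprime_dvd_left (Nat.lcm_dvd_mul _ _) ((hmcop n).mul_left (hcop n))
    · rw [← Nat.factorizationLCMLeft_mul_factorizationLCMRight hm hh]
      exact ⟨_, (hf'.castHom (Nat.factorizationLCMLeft_dvd_left _ _)).chineseRemainder
        (hf.castHom (Nat.factorizationLCMRight_dvd_right _ _))
        (Nat.coprime_factorizationLCMLeft_factorizationLCMRight _ _)⟩
  have hle := le_csSup hbdd hlcm
  have := Nat.dvd_lcm_right m (sSup S)
  rw [← Nat.le_antisymm hle (Nat.le_of_dvd (Nat.pos_of_ne_zero hlcm.1) this)]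
  exact Nat.dvd_lcm_left m (sSup S)

/-- By uniqueness up to a constant, `f` is the reduction of `g` mod `d` plus a constant. -/
theorem _root_.IsCyclicFactor.eq_of_dvd {X : Type u} [TopologicalSpace X] {T : X ≃ₜ X}
    (hT : IsMinimalSystem T) {m d : ℕ} (hd : d ∣ m) {g : X → ZMod m} (hg : IsCyclicFactor T m g)
    {f : X → ZMod d} (hf : IsCyclicFactor T d f) {x y : X} (h : g x = g y) : f x = f y := by
  have := (hg.castHom hd).eq_add_const hT hf x y
  rw [h] at this
  simpa using this

/-- Points that are not separated by the cyclic factors of orders `p n` and `h` are not separated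
by any finite cyclic factor. -/
theorem IsTorsionFree.isCyclicFactor_eq (hθ : θ.IsTorsionFree q) {h : ℕ}
    (hdvd : ∀ m : ℕ, m ≠ 0 → (∀ n, m.Coprime (q n)) →
      (∃ f : θ.levelShift 0 → ZMod m, IsCyclicFactor θ.shiftMap m f) → m ∣ h)
    {g : ∀ n, θ.levelShift 0 → ZMod (lengthProd q n)}
    (hg : ∀ n, IsCyclicFactor θ.shiftMap (lengthProd q n) (g n))
    {e : θ.levelShift 0 → ZMod h} (he : IsCyclicFactor θ.shiftMap h e)
    {x y : θ.levelShift 0} (hgxy : ∀ n, g n x = g n y) (hexy : e x = e y)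
    (m : ℕ) (hm : m ≠ 0) : ∀ (f : θ.levelShift 0 → ZMod m), IsCyclicFactor θ.shiftMap m f →
      f x = f y := by
  induction m using Nat.recOnPosPrimePosCoprime with
  | zero => exact absurd rfl hm
  | one => exact fun f _ => Subsingleton.elim _ _
  | prime_pow p a hpp ha =>
    intro f hf
    -- Either p^a divides some p_n, or it is coprime to every length and then divides `h`.
    by_cases hpq : ∃ k, p ∣ q k
    · obtain ⟨k, hk⟩ := hpq
      obtain ⟨n, hn⟩ := exists_pow_dvd_lengthProd (hθ.frequently_dvd p hpp k hk) a
      exact (hg n).eq_of_dvd hθ.isMinimalSystem hn hf (hgxy n)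
    · push Not at hpq
      have := hdvd (p ^ a) hm
        (fun n => Nat.Coprime.pow_left a ((Nat.Prime.coprime_iff_not_dvd hpp).2 (hpq n))) ⟨f, hf⟩
      exact he.eq_of_dvd hθ.isMinimalSystem this hf hexy
  | coprime a b ha hb hab iha ihb =>
    intro f hf
    have h1 := iha (by omega) _ (hf.castHom (dvd_mul_right a b))
    have h2 := ihb (by omega) _ (hf.castHom (dvd_mul_left b a))
    have e1 : (RingHom.fst _ _).comp (ZMod.chineseRemainder hab).toRingHom =
      ZMod.castHom (dvd_mul_right a b) (ZMod a) := Subsingleton.elim _ _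
    have e2 : (RingHom.snd _ _).comp (ZMod.chineseRemainder hab).toRingHom =
      ZMod.castHom (dvd_mul_left b a) (ZMod b) := Subsingleton.elim _ _
    rw [← e1] at h1
    rw [← e2] at h2
    apply (ZMod.chineseRemainder hab).injective
    exact Prod.ext h1 h2

/-! ### Almost periodic functions -/

/-- An almost periodic function on a torsion-free shift does not separate points that are not
separated by finite cyclic factors. -/
theorem IsTorsionFree.eq_of_almostPeriodic (hθ : θ.IsTorsionFree q) {K : ℕ}
    (hK : ∀ n, Nat.card (A n) ≤ K) {M : Type v} [MetricSpace M] (F : θ.levelShift 0 → M)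
    (hF : ∀ ε > 0, ∀ u, ∀ᶠ v in nhds u, ∀ k : ℤ,
      dist (F ((θ.shiftMap ^ k) u)) (F ((θ.shiftMap ^ k) v)) < ε)
    {x y : θ.levelShift 0}
    (hxy : ∀ m : ℕ, m ≠ 0 → ∀ f : θ.levelShift 0 → ZMod m, IsCyclicFactor θ.shiftMap m f →
      f x = f y) : F x = F y := by
  have hne := hθ.nonempty_levelShift
  have main : ∀ ε > 0, dist (F x) (F y) ≤ (2 * K + 1 : ℕ) * ε := by
    intro ε hε
    let D : ℕ → θ.levelShift 0 → θ.levelShift 0 → Prop := fun j u v =>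
      ∀ k : ℤ, dist (F ((θ.shiftMap ^ k) u)) (F ((θ.shiftMap ^ k) v)) ≤ j * ε
    have hDinv : ∀ (k : ℤ) {j u v}, D j u v → D j ((θ.shiftMap ^ k) u) ((θ.shiftMap ^ k) v) := by
      intro k j u v h i
      rw [← Homeomorph.zpow_add_apply, ← Homeomorph.zpow_add_apply]
      exact h (i + k)
    have hDsymm : ∀ {j u v}, D j u v → D j v u := fun h k => by rw [dist_comm]; exact h k
    obtain ⟨r, hr⟩ := exists_uniform_window (hF (ε / 2) (by positivity))
    have hr' : ∀ v v' : θ.levelShift 0, (∀ i ∈ Finset.Icc (-r : ℤ) r, v.1 i = v'.1 i) →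
        D 1 v v' := by
      intro v v' hv k
      obtain ⟨u, h1, h2⟩ := hr v v' hv
      have := dist_triangle_left (F ((θ.shiftMap ^ k) v)) (F ((θ.shiftMap ^ k) v'))
        (F ((θ.shiftMap ^ k) u))
      have h1 := h1 k
      have h2 := h2 k
      push_cast
      linarith
    obtain ⟨n, hn⟩ := hθ.exists_le_lengthProd (2 * r + 1)
    obtain ⟨g, hg⟩ := hθ.exists_isCyclicFactor_lengthProd hK n
    -- Requiring equal values of `g` keeps chains inside one fibre, where `exists_label` supplies
    -- the cliques. Their number is at most K however large n is, so the final bound depends on ε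
    -- alone.
    let R : θ.levelShift 0 → θ.levelShift 0 → Prop := fun u v => D 1 u v ∧ g u = g v
    have hRinv : ∀ (k : ℤ) {u v}, R u v → R ((θ.shiftMap ^ k) u) ((θ.shiftMap ^ k) v) :=
      fun k u v h => ⟨hDinv k h.1, by rw [hg.map_zpow, hg.map_zpow, h.2]⟩
    have hRsymm : Std.Symm R := ⟨fun u v h => ⟨hDsymm h.1, h.2.symm⟩⟩
    let s : Setoid (θ.levelShift 0) :=
      { r := Relation.ReflTransGen R
        iseqv := ⟨fun _ => Relation.ReflTransGen.refl,
          fun h => (Relation.ReflTransGen.stdSymm (r := R)).symm _ _ h, Relation.ReflTransGen.trans⟩ }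
    obtain ⟨m, f, hm, hf, hker⟩ := hθ.isMinimalSystem.exists_isCyclicFactor_of_setoid s
      (fun u v => ⟨fun h => by
          have := Relation.ReflTransGen.lift (p := R) (θ.shiftMap ^ (-1 : ℤ))
            (fun a b => hRinv (-1) (u := a) (v := b)) _ _ h
          rw [Function.onFun] at this
          have e : ∀ z, (θ.shiftMap ^ (-1 : ℤ)) (θ.shiftMap z) = z := fun z => by
            rw [← Homeomorph.zpow_apply_apply, neg_add_cancel, Homeomorph.zpow_zero_apply]
          rwa [e, e] at this,
        fun h => by
          have := Relation.ReflTransGen.lift (p := R) (θ.shiftMap ^ (1 : ℤ))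
            (fun a b => hRinv 1 (u := a) (v := b)) _ _ h
          rw [Function.onFun] at this
          rwa [zpow_one] at this⟩)
      (fun u => by
        rw [isOpen_iff_mem_nhds]
        intro v hv
        filter_upwards [hF ε hε v,
          (IsLocallyConstant.iff_eventually_eq g).1 hg.isLocallyConstant v] with z hz hgz
        exact Relation.ReflTransGen.tail hv
          ⟨fun k => by rw [Nat.cast_one, one_mul]; exact (hz k).le, hgz.symm⟩)
    have hchain : Relation.ReflTransGen R x y := (hker x y).1 (hxy m hm.ne' f hf)
    obtain ⟨k, l, hl⟩ := hθ.exists_label hg hn x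
    obtain ⟨hy, hchain'⟩ : ∃ hy : g y = g x, Relation.ReflTransGen
        (fun u v : {u // g u = g x} => D 1 u.1 v.1) ⟨x, rfl⟩ ⟨y, hy⟩ := by
      clear hxy
      induction hchain with
      | refl => exact ⟨rfl, Relation.ReflTransGen.refl⟩
      | tail _ h ih =>
        obtain ⟨hb, ih⟩ := ih
        exact ⟨h.2.symm.trans hb, ih.tail h.1⟩
    have hD := rel_of_reflTransGen_of_finite_cliques l (fun j u v => D j u.1 v.1)
      (fun i j a b c hab hbc k => by
        have := dist_triangle (F ((θ.shiftMap ^ k) a.1)) (F ((θ.shiftMap ^ k) b.1))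
          (F ((θ.shiftMap ^ k) c.1))
        have h1 := hab k
        have h2 := hbc k
        push_cast
        linarith)
      (fun a b h => hDsymm h)
      (fun i j a b hij h k => (h k).trans (by gcongr))
      -- Equal labels give agreement on the window only after applying σ^k; closeness along whole
      -- orbits can be shifted back.
      (fun a b hab => by
        have := hDinv (-k) (hr' _ _ (hl a b hab))
        rwa [Homeomorph.zpow_neg_apply_zpow, Homeomorph.zpow_neg_apply_zpow] at this)
      hchain'
    have h0 := hD 0
    simp only [Homeomorph.zpow_zero_apply] at h0
    refine h0.trans ?_
    gcongr
    exact hK n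
  apply dist_le_zero.1
  apply le_of_forall_pos_le_add
  intro δ hδ
  have := main (δ / (2 * K + 1 : ℕ)) (by positivity)
  rwa [mul_div_cancel₀ _ (by positivity), ← zero_add δ] at this

end Cyclic

end DirectiveSequence

/-! ### The rotation of the odometer -/

section OdometerRotation

instance ZMod.discreteUniformity (N : ℕ) : DiscreteUniformity (ZMod N) := ⟨rfl⟩

instance ZMod.isUniformAddGroup (N : ℕ) : IsUniformAddGroup (ZMod N) where
  uniformContinuous_sub := DiscreteUniformity.uniformContinuous _ _

instance Odometer.isUniformAddGroup (q : ℕ → ℕ) : IsUniformAddGroup (Odometer q) :=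
  IsUniformAddGroup.comap (Odometer q).subtype

variable {q : ℕ → ℕ} {h : ℕ}

theorem odometerRotation_apply (z : Odometer q × ZMod h) :
    odometerRotation q h z = z + (1, 1) := rfl

theorem equicontinuous_zpow_odometerRotation (q : ℕ → ℕ) (h : ℕ) :
    Equicontinuous (fun (n : ℤ) (z : Odometer q × ZMod h) => (odometerRotation q h ^ n) z) := by
  have hsub : ∀ (n : ℤ) (z w : Odometer q × ZMod h),
      (odometerRotation q h ^ n) w - (odometerRotation q h ^ n) z = w - z := by
    intro n
    induction n with
    | zero => intro z w; simp
    | succ n ih =>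
      intro z w
      rw [Homeomorph.zpow_apply_apply, Homeomorph.zpow_apply_apply, ih, odometerRotation_apply,
        odometerRotation_apply, add_sub_add_right_eq_sub]
    | pred n ih =>
      intro z w
      have := ih z w
      rwa [← sub_add_cancel (-(n : ℤ)) 1, Homeomorph.zpow_one_add_apply,
        Homeomorph.zpow_one_add_apply, odometerRotation_apply, odometerRotation_apply,
        add_sub_add_right_eq_sub] at this
  intro z U hU
  rw [uniformity_eq_comap_nhds_zero, Filter.mem_comap] at hU
  obtain ⟨V, hV, hVU⟩ := hU
  have : Tendsto (fun w => w - z) (nhds z) (nhds 0) := by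
    rw [← sub_self z]
    exact (continuous_id.sub continuous_const).tendsto z
  filter_upwards [this hV] with w hw n
  apply hVU
  simp only [Set.mem_preimage, hsub]
  exact hw

theorem Odometer.castHom_apply (z : Odometer q) {i n : ℕ} (hin : i ≤ n) :
    ZMod.castHom (lengthProd_dvd (q := q) hin) (ZMod (lengthProd q i)) (z.1 n) = z.1 i := by
  induction n, hin using Nat.le_induction with
  | base => simp
  | succ n hin ih =>
    rw [← ih, ← z.2 n, ← RingHom.comp_apply]
    congr 1
    exact Subsingleton.elim _ _

theorem Odometer.apply_eq_of_le {z w : Odometer q} {i n : ℕ} (hin : i ≤ n) (h : z.1 n = w.1 n) :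
    z.1 i = w.1 i := by
  rw [← Odometer.castHom_apply z hin, ← Odometer.castHom_apply w hin, h]

/-- Agreement at coordinate n forces agreement at all lower ones, so each coordinate is eventually
constant. -/
theorem Odometer.tendsto_prod {u : ℕ → Odometer q × ZMod h} {z : Odometer q × ZMod h}
    (h1 : ∀ n, (u n).1.1 n = z.1.1 n) (h2 : ∀ n, (u n).2 = z.2) :
    Tendsto u atTop (nhds z) := by
  rw [Prod.tendsto_iff, tendsto_subtype_rng, tendsto_pi_nhds]
  refine ⟨fun i => tendsto_const_nhds.congr' ?_, tendsto_const_nhds.congr fun n => (h2 n).symm⟩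
  filter_upwards [eventually_ge_atTop i] with n hn
  exact (Odometer.apply_eq_of_le hn (h1 n)).symm

end OdometerRotation

/-! ### Roots of unity -/

/-- On the unit circle within distance 1 of 1, ‖z + 1‖ ≥ 3/2, so squaring expands the distance to 1
by a factor 3/2; the powers c^(2^j) would eventually leave this disc. -/
theorem Complex.eq_one_of_forall_norm_pow_sub_one_le {c : ℂ} (hc : ‖c‖ = 1)
    (h : ∀ k : ℕ, ‖c ^ k - 1‖ ≤ 1) : c = 1 := by
  have key : ∀ z : ℂ, ‖z‖ = 1 → ‖z - 1‖ ≤ 1 → 3 / 2 * ‖z - 1‖ ≤ ‖z ^ 2 - 1‖ := by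
    intro z hz h1
    have hre : (1 : ℝ) / 2 ≤ z.re := by
      have e1 : z.re ^ 2 + z.im ^ 2 = 1 := by
        have := Complex.sq_norm z
        rw [hz, Complex.normSq_apply] at this
        nlinarith
      have e2 : (z.re - 1) ^ 2 + z.im ^ 2 ≤ 1 := by
        have := Complex.sq_norm (z - 1)
        rw [Complex.normSq_apply] at this
        simp only [Complex.sub_re, Complex.sub_im, Complex.one_re, Complex.one_im] at this
        nlinarith [norm_nonneg (z - 1)]
      nlinarith
    have h2 : 3 / 2 ≤ ‖z + 1‖ := by
      have := Complex.re_le_norm (z + 1)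
      simp only [Complex.add_re, Complex.one_re] at this
      linarith
    have : z ^ 2 - 1 = (z + 1) * (z - 1) := by ring
    rw [this, norm_mul]
    gcongr
  have hpow : ∀ j : ℕ, (3 / 2 : ℝ) ^ j * ‖c - 1‖ ≤ ‖c ^ 2 ^ j - 1‖ := by
    intro j
    induction j with
    | zero => simp
    | succ j ih =>
      have := key (c ^ 2 ^ j) (by rw [norm_pow, hc, one_pow]) (h _)
      rw [← pow_mul, ← pow_succ] at this
      rw [pow_succ]
      linarith
  by_contra hne
  have hpos : 0 < ‖c - 1‖ := norm_pos_iff.2 (sub_ne_zero.2 hne)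
  obtain ⟨j, hj⟩ := pow_unbounded_of_one_lt (1 / ‖c - 1‖) (show (1 : ℝ) < 3 / 2 by norm_num)
  rw [div_lt_iff₀ hpos] at hj
  linarith [hpow j, h (2 ^ j)]

theorem isRationalEigenvalue_of_pow_eq_one {c : ℂ} {N : ℕ} (hN : 0 < N) (h : c ^ N = 1) :
    IsRationalEigenvalue c := by
  have : NeZero N := ⟨hN.ne'⟩
  obtain ⟨i, -, rfl⟩ := (Complex.isPrimitiveRoot_exp N hN.ne').eq_pow_of_pow_eq_one h
  refine ⟨i, N, hN, ?_⟩
  rw [← Complex.exp_nat_mul]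
  congr 1
  push_cast
  ring

/-! ### Almost periodicity of functions on equicontinuous factors -/

section Factor

theorem IsFactorMap.map_zpow {X : Type u} {Y : Type v} [TopologicalSpace X] [TopologicalSpace Y]
    {T : X ≃ₜ X} {S : Y ≃ₜ Y} {φ : X → Y} (hφ : IsFactorMap T S φ) (k : ℤ) :
    ∀ x, φ ((T ^ k) x) = (S ^ k) (φ x) := by
  induction k with
  | zero => intro x; simp
  | succ k ih =>
    intro x
    rw [Homeomorph.zpow_one_add_apply, Homeomorph.zpow_one_add_apply, hφ.semiconj, ih]
  | pred k ih =>
    intro x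
    apply S.injective
    rw [← hφ.semiconj, ← Homeomorph.zpow_one_add_apply, ← Homeomorph.zpow_one_add_apply,
      sub_add_cancel, ih]

/-- Compactness makes `f` uniformly continuous, so equicontinuity of the factor pulls back to the
almost periodicity hypothesis of `eq_of_almostPeriodic`. -/
theorem IsEquicontinuousSystem.eventually_dist_lt {X : Type u} {Y : Type v} [TopologicalSpace X]
    [UniformSpace Y] {T : X ≃ₜ X} {S : Y ≃ₜ Y} {φ : X → Y} (hS : IsEquicontinuousSystem S)
    (hφ : IsFactorMap T S φ) {M : Type w} [PseudoMetricSpace M] {f : Y → M} (hf : Continuous f)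
    {ε : ℝ} (hε : 0 < ε) (u : X) :
    ∀ᶠ v in nhds u, ∀ k : ℤ, dist (f (φ ((T ^ k) u))) (f (φ ((T ^ k) v))) < ε := by
  have := hS.compactSpace
  have hunif := CompactSpace.uniformContinuous_of_continuous hf
  have hU := hunif (Metric.dist_mem_uniformity hε)
  have h := (hφ.continuous.tendsto u).eventually (hS.equicontinuous (φ u) _ hU)
  filter_upwards [h] with v hv k
  rw [hφ.map_zpow, hφ.map_zpow]
  exact hv k

end Factor

/-! ### The maximal equicontinuous factor -/

namespace DirectiveSequence

variable {A : ℕ → Type u} [∀ n, TopologicalSpace (A n)] {θ : DirectiveSequence A} {q : ℕ → ℕ}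
  [∀ n, Finite (A n)] [∀ n, DiscreteTopology (A n)]

/-- The cyclic factors of orders `p n` and `h` combine to a factor map onto the odometer times
`ℤ / h`. -/
theorem IsTorsionFree.exists_isFactorMap_odometerRotation (hθ : θ.IsTorsionFree q) {K : ℕ}
    (hK : ∀ n, Nat.card (A n) ≤ K) {h : ℕ} (hcop : ∀ n, h.Coprime (q n))
    {e : θ.levelShift 0 → ZMod h} (he : IsCyclicFactor θ.shiftMap h e) :
    ∃ (g : ∀ n, θ.levelShift 0 → ZMod (lengthProd q n)) (π : θ.levelShift 0 → Odometer q × ZMod h),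
      (∀ n, IsCyclicFactor θ.shiftMap (lengthProd q n) (g n)) ∧
      (∀ x n, (π x).1.1 n = g n x) ∧ (∀ x, (π x).2 = e x) ∧
      IsFactorMap θ.shiftMap (odometerRotation q h) π := by
  obtain ⟨x₀⟩ := hθ.nonempty_levelShift
  choose f hf using hθ.exists_isCyclicFactor_lengthProd hK
  -- Cyclic factor maps are unique up to constants; vanishing at a common base point makes them
  -- compatible under reduction.
  let g : ∀ n, θ.levelShift 0 → ZMod (lengthProd q n) := fun n x => f n x + -f n x₀
  have hg : ∀ n, IsCyclicFactor θ.shiftMap (lengthProd q n) (g n) := fun n =>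
    (hf n).add_const _
  have hg0 : ∀ n, g n x₀ = 0 := fun n => add_neg_cancel _
  have hcompat : ∀ x n, ZMod.castHom (lengthProd_dvd_succ q n) (ZMod (lengthProd q n))
      (g (n + 1) x) = g n x := by
    intro x n
    rw [((hg (n + 1)).castHom (lengthProd_dvd_succ q n)).eq_add_const hθ.isMinimalSystem (hg n)
      x x₀, hg0, hg0, map_zero, sub_zero, add_zero]
  let π : θ.levelShift 0 → Odometer q × ZMod h := fun x =>
    (⟨fun n => g n x, hcompat x⟩, e x)
  have hcont : Continuous π :=
    (Continuous.subtype_mk (continuous_pi fun n => (hg n).isLocallyConstant.continuous) _).prodMk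
      he.isLocallyConstant.continuous
  refine ⟨g, π, hg, fun _ _ => rfl, fun _ => rfl, hcont, ?_, ?_⟩
  · intro z
    -- Since h and p_n are coprime, one integer realizes both residues. So the orbit of π x₀ is
    -- dense, and the range of π is compact.
    have hk : ∀ n, ∃ k : ℤ, ((k : ℤ) : ZMod (lengthProd q n)) = z.1.1 n ∧
        ((k : ℤ) : ZMod h) = z.2 - e x₀ := by
      intro n
      have hc := (coprime_lengthProd hcop n).symm
      obtain ⟨k, hk⟩ := ZMod.intCast_surjective
        ((ZMod.chineseRemainder hc).symm (z.1.1 n, z.2 - e x₀))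
      have := congrArg (ZMod.chineseRemainder hc) hk
      rw [map_intCast, RingEquiv.apply_symm_apply] at this
      exact ⟨k, congrArg Prod.fst this, congrArg Prod.snd this⟩
    choose k hk1 hk2 using hk
    have htend : Tendsto (fun n => π ((θ.shiftMap ^ k n) x₀)) atTop (nhds z) :=
      Odometer.tendsto_prod
        (fun n => by
          change g n _ = _
          rw [(hg n).map_zpow, hg0, zero_add, hk1])
        (fun n => by
          change e _ = _
          rw [he.map_zpow, hk2, add_sub_cancel])
    have hclosed : IsClosed (Set.range π) := (isCompact_range hcont).isClosed
    exact hclosed.mem_of_tendsto htend (Eventually.of_forall fun n => ⟨_, rfl⟩)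
  · intro x
    rw [odometerRotation_apply]
    refine Prod.ext (Subtype.ext (funext fun n => ?_)) ?_
    · exact (hg n).map_apply x
    · exact he.map_apply x

end DirectiveSequence

theorem corollary4p6 {A : ℕ → Type u} [∀ n, Finite (A n)] [∀ n, TopologicalSpace (A n)]
    [∀ n, DiscreteTopology (A n)] (hA : HasBoundedAlphabets A)
    (θ : DirectiveSequence A) (q : ℕ → ℕ) (hθ : θ.IsTorsionFree q) :
    (∃ h : ℕ, 0 < h ∧ (∀ n, Nat.Coprime h (q n)) ∧
      ∃ π : θ.levelShift 0 → Odometer q × ZMod h,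
        IsMaximalEquicontinuousFactor.{u, 0, w} θ.shiftMap (odometerRotation q h) π) ∧
    ∀ c : ℂ, IsContinuousEigenvalue θ.shiftMap c → IsRationalEigenvalue c := by
  obtain ⟨K, hK⟩ := hA
  obtain ⟨h, hpos, hcop, ⟨e, he⟩, hdvd⟩ := hθ.exists_height hK
  obtain ⟨g, π, hg, hπg, hπe, hπ⟩ := hθ.exists_isFactorMap_odometerRotation hK hcop he
  have hcyc : ∀ {x y : θ.levelShift 0}, π x = π y → ∀ m : ℕ, m ≠ 0 →
      ∀ f : θ.levelShift 0 → ZMod m, IsCyclicFactor θ.shiftMap m f → f x = f y := by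
    intro x y hxy m hm f hf
    refine hθ.isCyclicFactor_eq hdvd hg he (fun n => ?_) ?_ m hm f hf
    · rw [← hπg, ← hπg, hxy]
    · rw [← hπe, ← hπe, hxy]
  have hquot : Topology.IsQuotientMap π :=
    Topology.IsQuotientMap.of_surjective_continuous hπ.surjective hπ.continuous
  have hcompact : CompactSpace (Odometer q × ZMod h) :=
    hπ.surjective.compactSpace hπ.continuous
  refine ⟨⟨h, hpos, hcop, π, ⟨hcompact, inferInstance,
    equicontinuous_zpow_odometerRotation q h⟩, hπ, ?_⟩, ?_⟩
  · intro Y _ S φ hS hφ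
    have := hS.compactSpace
    have := hS.t2Space
    have hker : ∀ x y, π x = π y → φ x = φ y := by
      intro x y hxy
      by_contra hne
      -- `Y` need not be metrizable, so the two points are separated by an Urysohn function and the
      -- result for real-valued functions is used.
      obtain ⟨f, hf0, hf1, -⟩ := exists_continuous_zero_one_of_isClosed
        (isClosed_singleton (x := φ x)) (isClosed_singleton (x := φ y))
        (Set.disjoint_singleton.2 hne)
      have hf := hθ.eq_of_almostPeriodic hK (fun z => f (φ z))
        (fun ε hε u => hS.eventually_dist_lt hφ f.continuous hε u) (hcyc hxy)
      have h0 : f (φ x) = 0 := hf0 rfl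
      have h1 : f (φ y) = 1 := hf1 rfl
      rw [h0, h1] at hf
      exact zero_ne_one hf
    have hlift : ∀ x, φ (Function.surjInv hπ.surjective (π x)) = φ x := fun x =>
      hker _ _ (Function.surjInv_eq hπ.surjective (π x))
    refine ⟨fun z => φ (Function.surjInv hπ.surjective z), ⟨?_, ?_, ?_⟩, hlift⟩
    · rw [hquot.continuous_iff]
      exact hφ.continuous.congr fun x => (hlift x).symm
    · intro y
      obtain ⟨x, rfl⟩ := hφ.surjective y
      exact ⟨π x, hlift x⟩
    · intro z
      obtain ⟨x, rfl⟩ := hπ.surjective z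
      rw [← hπ.semiconj, hlift, hlift, hφ.semiconj]
  · rintro c ⟨hc, f, hf, hf0, hfc⟩
    have := hθ.nonempty
    have hfz : ∀ (k : ℕ) x, f ((θ.shiftMap ^ (k : ℤ)) x) = c ^ k * f x := by
      intro k
      induction k with
      | zero => intro x; simp
      | succ k ih =>
        intro x
        rw [Nat.cast_succ, Homeomorph.zpow_one_add_apply, hfc, ih, pow_succ]
        ring
    have hdist : ∀ (u v : θ.levelShift 0) (k : ℤ),
        dist (f ((θ.shiftMap ^ k) u)) (f ((θ.shiftMap ^ k) v)) = dist (f u) (f v) := by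
      have h1 : ∀ u v : θ.levelShift 0, dist (f (θ.shiftMap u)) (f (θ.shiftMap v)) =
          dist (f u) (f v) := by
        intro u v
        rw [hfc, hfc, dist_eq_norm, ← mul_sub, norm_mul, hc, one_mul, dist_eq_norm]
      intro u v k
      induction k with
      | zero => simp
      | succ k ih => rw [Homeomorph.zpow_one_add_apply, Homeomorph.zpow_one_add_apply, h1, ih]
      | pred k ih =>
        rw [← h1, ← Homeomorph.zpow_one_add_apply, ← Homeomorph.zpow_one_add_apply,
          sub_add_cancel, ih]
    have hker : ∀ x y, π x = π y → f x = f y := fun x y hxy =>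
      hθ.eq_of_almostPeriodic hK f (fun ε hε u => by
        filter_upwards [hf.continuousAt.eventually (Metric.ball_mem_nhds (f u) hε)] with v hv k
        rw [hdist, dist_comm]
        exact hv) (hcyc hxy)
    have hlift : ∀ x, f (Function.surjInv hπ.surjective (π x)) = f x := fun x =>
      hker _ _ (Function.surjInv_eq hπ.surjective (π x))
    have hψ : Continuous fun z => f (Function.surjInv hπ.surjective z) := by
      rw [hquot.continuous_iff]
      exact hf.congr fun x => (hlift x).symm
    obtain ⟨x, hx⟩ := Function.ne_iff.1 hf0
    -- Powers of the shift divisible by p_n h fix coordinate n and the ℤ/h component of π x. By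
    -- continuity of the descended eigenfunction, all c^(p_n h k) are then near 1 uniformly in k for
    -- some n, which forces c^(p_n h) = 1.
    obtain ⟨n, hn⟩ : ∃ n, ∀ k : ℕ, ‖(c ^ (lengthProd q n * h)) ^ k - 1‖ ≤ 1 := by
      by_contra! hcon
      choose k hk using hcon
      have htend : Tendsto (fun n => π ((θ.shiftMap ^ ((lengthProd q n * h * k n : ℕ) : ℤ)) x))
          atTop (nhds (π x)) := Odometer.tendsto_prod
        (fun n => by rw [hπg, hπg, (hg n).map_zpow]; simp)
        (fun n => by rw [hπe, hπe, he.map_zpow]; simp)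
      have hlim := (hψ.tendsto (π x)).comp htend
      simp only [Function.comp_def, hlift, hfz] at hlim
      have hlim' := (hlim.div_const (f x)).sub_const 1
      simp only [mul_div_cancel_right₀ _ hx, div_self hx, sub_self] at hlim'
      obtain ⟨n, hn⟩ := ((Metric.tendsto_nhds.1 hlim') 1 one_pos).exists
      rw [dist_zero_right, pow_mul] at hn
      exact absurd (hk n) (not_lt.2 hn.le)
    exact isRationalEigenvalue_of_pow_eq_one
      (Nat.mul_pos (hθ.hasLengthSequence.lengthProd_pos n) hpos)
      (Complex.eq_one_of_forall_norm_pow_sub_one_le (by rw [norm_pow, hc, one_pow]) hn)
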